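/- Let $S_{1,2,2}$ denote the graph with vertices $u,x_1,y_1,y_2,z_1,z_2$ and edges $ux_1$, $uy_1$, $y_1y_2$, $uz_1$, $z_1z_2$; let $K_3$ be the triangle and $C_5$ the chordless cycle on five vertices. The clique-width $cw(G)$ of a finite nonempty graph $G$ is the minimum number of labels needed to construct $G$, up to isomorphism, by the following four operations on vertex-labelled graphs: creating a new vertex with a label; taking the disjoint union of two vertex-labelled graphs; for labels $i\neq j$, adding all edges between the vertices labelled $i$ and the vertices labelled $j$; and renaming label $i$ to $j$. Theorem. The finite $(S_{1,2,2},K_3)$-free graphs containing a $C_5$ have bounded clique-width: there is a constant $k\in\mathbb N$ such that every finite simple graph $G$ that has no induced subgraph isomorphic to $S_{1,2,2}$ or to $K_3$, and that has an induced subgraph isomorphic to $C_5$, satisfies $cw(G)\le k$. -/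

import Mathlib

/-- A clique-width expression with labels in `Fin k`, built from the four operations:
creating a vertex with a label, disjoint union, adding all edges between the vertices labelled `i`
and the vertices labelled `j` (for `i ≠ j`), and renaming label `i` to `j`. -/
inductive CliqueWidthExpr (k : ℕ) : Type
  | vertex (l : Fin k) : CliqueWidthExpr k
  | union (e₁ e₂ : CliqueWidthExpr k) : CliqueWidthExpr k
  | join (i j : Fin k) (hij : i ≠ j) (e : CliqueWidthExpr k) : CliqueWidthExpr k
  | relabel (i j : Fin k) (e : CliqueWidthExpr k) : CliqueWidthExpr k

namespace CliqueWidthExpr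

/-- The vertex set of the labelled graph built by an expression. -/
def Vert {k : ℕ} : CliqueWidthExpr k → Type
  | vertex _ => Unit
  | union e₁ e₂ => Vert e₁ ⊕ Vert e₂
  | join _ _ _ e => Vert e
  | relabel _ _ e => Vert e

/-- The vertex labels of the labelled graph built by an expression. -/
def label {k : ℕ} : (e : CliqueWidthExpr k) → e.Vert → Fin k
  | vertex l => fun _ => l
  | union e₁ e₂ => Sum.elim (label e₁) (label e₂)
  | join _ _ _ e => label e
  | relabel i j e => fun x => if label e x = i then j else label e x

/-- The underlying graph of the labelled graph built by an expression. -/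
def graph {k : ℕ} : (e : CliqueWidthExpr k) → SimpleGraph e.Vert
  | vertex _ => ⊥
  | union e₁ e₂ => SimpleGraph.sum (graph e₁) (graph e₂)
  | join i j _ e => graph e ⊔ SimpleGraph.fromRel (fun x y => label e x = i ∧ label e y = j)
  | relabel _ _ e => graph e

end CliqueWidthExpr

/-- The clique-width of a graph: the least number `k` of labels for which some expression with
labels in `Fin k` builds a graph isomorphic to `G`, and `⊤` if there is none. Every nonempty finite
graph has a finite clique-width; an infinite graph, or one with no vertex, is never built. -/
noncomputable def cliqueWidth {V : Type*} (G : SimpleGraph V) : ℕ∞ :=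
  ⨅ (k : ℕ) (_ : ∃ e : CliqueWidthExpr k, Nonempty (G ≃g e.graph)), (k : ℕ∞)

/-- The graph `S_{i,j,k}`: a centre `none` with three pendant paths attached to it, having
`i`, `j` and `k` further vertices. -/
def subdividedClaw (i j k : ℕ) : SimpleGraph (Option (Fin i ⊕ Fin j ⊕ Fin k)) :=
  SimpleGraph.fromRel fun u v =>
    match u, v with
    | none, some (.inl a) => (a : ℕ) = 0
    | none, some (.inr (.inl a)) => (a : ℕ) = 0
    | none, some (.inr (.inr a)) => (a : ℕ) = 0
    | some (.inl a), some (.inl b) => (b : ℕ) = a + 1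
    | some (.inr (.inl a)), some (.inr (.inl b)) => (b : ℕ) = a + 1
    | some (.inr (.inr a)), some (.inr (.inr b)) => (b : ℕ) = a + 1
    | _, _ => False

/-! Clique-width is bounded once the vertex set can be divided recursively into single vertices
along cuts with boundedly many adjacency classes (`BranchTree` over `CutBound`, turned into
expressions by `builtOn_of_branchTree`). Such trees can be glued along splits, that is, cuts whose
edges form one complete bipartite graph: a single vertex stands for the far side. Hence
`branchTree_of_splitFree` reduces a hereditary class to its split-free members. The pieces of a
split need not contain a five-cycle, so all split-free triangle- and fork-free graphs are treated.
With at least four vertices they are connected and have no twins, and there are three cases.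

With a five-cycle, connectivity makes every vertex adjacent to the cycle, and it either imitates one
cycle vertex (a copy) or has a single neighbour on the cycle (a pendant). Fork-freeness determines
adjacency by type, except inside five blocks where the deviations are chain graphs compatible with
one linear order.

Without pentagons but with an induced cycle of length at least seven, each neighbour of the cycle is
a twin of a cycle vertex, so the cycle is the whole graph.

With neither, the graph is layered from a vertex `u` of maximum degree. The second layer is
independent, the sets of neighbours of `u` missed by its vertices are pairwise nested or disjoint,
and at most one vertex lies further away. Up to two vertices, the graph is bipartite and its
bipartite complement is a disjoint union of chain graphs.

Every case with at least four vertices ends with a linear layout whose prefixes have boundedly many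
neighbourhood classes (`branchTree_of_layout`). -/

/-! ### Trees of vertex subsets and their rerooting. -/

section Branch

open Set

variable {V : Type*}

/-- A rooted binary tree of subsets of `V`, all of which satisfy `P`: the leaves are singletons,
each inner node is the disjoint union of its children, and the root is the given set. -/
inductive BranchTree (P : Set V → Prop) : Set V → Prop
  | single (x : V) : P {x} → BranchTree P {x}
  | union (S T : Set V) : Disjoint S T → BranchTree P S → BranchTree P T → P (S ∪ T) →
      BranchTree P (S ∪ T)

namespace BranchTree

variable {P : Set V → Prop}

theorem holds {S : Set V} (h : BranchTree P S) : P S := by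
  cases h <;> assumption

theorem map {V' : Type*} {Q : Set V' → Prop} (f : V → V') (hf : Function.Injective f)
    {S : Set V} (h : BranchTree P S) (hPQ : ∀ T ⊆ S, P T → Q (f '' T)) :
    BranchTree Q (f '' S) := by
  induction h with
  | single x hx =>
    have := hPQ _ subset_rfl hx
    rw [image_singleton] at this ⊢
    exact .single _ this
  | union S T hd hS hT hP ihS ihT =>
    have := hPQ _ subset_rfl hP
    rw [image_union] at this ⊢
    exact .union _ _ ((disjoint_image_iff hf).2 hd)
      (ihS fun U hU => hPQ U (hU.trans subset_union_left))
      (ihT fun U hU => hPQ U (hU.trans subset_union_right)) this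

theorem nonempty {S : Set V} (h : BranchTree P S) : S.Nonempty := by
  induction h with
  | single x hx => exact singleton_nonempty x
  | union S T _ _ _ _ ihS _ => exact ihS.inl

/-- The tree is unrooted in spirit: since `P` is closed under complements, each edge can be read
from either end. The induction descends towards the leaf `a` while carrying a tree on the complement
of the current node; the first alternative is the one-vertex case. -/
theorem reroot (hP : ∀ S, P S → P Sᶜ) {S : Set V} (h : BranchTree P S) {a : V} (ha : a ∈ S)
    (hS : S = univ ∨ BranchTree P Sᶜ) : S = {a} ∧ S = univ ∨ BranchTree P {a}ᶜ := by
  induction h with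
  | single x hx =>
    obtain rfl : a = x := ha
    rcases hS with hS | hS
    · exact .inl ⟨rfl, hS⟩
    · exact .inr hS
  | union S T hd hBS hBT hPU ihS ihT =>
    -- The complement of a child is its sibling together with the complement of the parent.
    have key : ∀ S T : Set V, Disjoint S T → BranchTree P S → BranchTree P T →
        (S ∪ T = univ ∨ BranchTree P (S ∪ T)ᶜ) → BranchTree P Sᶜ := by
      intro S T hd hBS hBT hU
      rcases hU with hU | hU
      · rwa [show Sᶜ = T from (IsCompl.compl_eq
          ⟨hd, codisjoint_iff.2 hU⟩)]
      · have e : Sᶜ = T ∪ (S ∪ T)ᶜ := by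
          ext x
          have : x ∈ S → x ∉ T := fun h1 h2 => disjoint_left.1 hd h1 h2
          simp only [mem_compl_iff, mem_union]
          tauto
        have := hP _ hBS.holds
        rw [e] at this ⊢
        refine .union _ _ ?_ hBT hU this
        exact disjoint_left.2 fun x hx hx' => hx' (.inr hx)
    rcases ha with ha | ha
    · have hc := key S T hd hBS hBT hS
      rcases ihS ha (.inr hc) with h | h
      · exact (hc.nonempty.ne_empty (by simp [h.2])).elim
      · exact .inr h
    · rw [union_comm] at hS
      have hc := key T S hd.symm hBT hBS hS
      rcases ihT ha (.inr hc) with h | h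
      · exact (hc.nonempty.ne_empty (by simp [h.2])).elim
      · exact .inr h

end BranchTree

end Branch

/-! ### Cut complexity and reduction to split-free graphs. -/

section Split

open Set

universe u

variable {V : Type u}

/-- The adjacencies between `S` and its complement are determined by labels from `Fin (k + 1)`,
where vertices labelled `0` have no neighbour across the cut. -/
def CutBound (G : SimpleGraph V) (k : ℕ) (S : Set V) : Prop :=
  ∃ (l : V → Fin (k + 1)) (M : Fin (k + 1) → Fin (k + 1) → Prop), (∀ j, ¬ M 0 j) ∧ (∀ i, ¬ M i 0) ∧
    ∀ x ∈ S, ∀ y ∉ S, G.Adj x y ↔ M (l x) (l y)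

theorem CutBound.compl {G : SimpleGraph V} {k : ℕ} {S : Set V} (h : CutBound G k S) :
    CutBound G k Sᶜ := by
  obtain ⟨l, M, h1, h2, h3⟩ := h
  refine ⟨l, fun i j => M j i, h2, h1, fun x hx y hy => ?_⟩
  rw [G.adj_comm]
  exact h3 y (not_not.1 hy) x hx

theorem cutBound_univ (G : SimpleGraph V) (k : ℕ) : CutBound G k univ :=
  ⟨fun _ => 0, fun _ _ => False, by simp, by simp, by simp⟩

theorem CutBound.mono {G : SimpleGraph V} {k m : ℕ} (hkm : k ≤ m) {S : Set V}
    (h : CutBound G k S) : CutBound G m S := by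
  obtain ⟨l, M, h1, h2, h3⟩ := h
  refine ⟨fun x => Fin.castLE (by omega) (l x), fun i j => ∃ i' j', Fin.castLE (by omega) i' = i ∧
    Fin.castLE (by omega) j' = j ∧ M i' j', ?_, ?_, fun x hx y hy => ?_⟩
  · rintro j ⟨i', j', hi, -, hM⟩
    obtain rfl : i' = 0 := by ext; simpa using congrArg Fin.val hi
    exact h1 _ hM
  · rintro i ⟨i', j', -, hj, hM⟩
    obtain rfl : j' = 0 := by ext; simpa using congrArg Fin.val hj
    exact h2 _ hM
  · rw [h3 x hx y hy]
    constructor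
    · exact fun h => ⟨_, _, rfl, rfl, h⟩
    · rintro ⟨i', j', hi, hj, hM⟩
      rwa [← Fin.castLE_injective _ hi, ← Fin.castLE_injective _ hj]

/-- If every pair of vertices of `S` with the same class has the same neighbours outside `S`,
then the cut has bounded complexity. -/
theorem cutBound_of_classes (G : SimpleGraph V) {κ : Type*} [Fintype κ] {m : ℕ}
    (hm : Fintype.card κ ≤ m) (S : Set V) (c : V → κ)
    (hc : ∀ x ∈ S, ∀ x' ∈ S, c x = c x' → ∀ y ∉ S, G.Adj x y → G.Adj x' y) :
    CutBound G (m + 2 ^ m) S := by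
  classical
  have hcard : Fintype.card (κ ⊕ Set κ) ≤ m + 2 ^ m := by
    rw [Fintype.card_sum, Fintype.card_set]
    exact add_le_add hm (Nat.pow_le_pow_right (by norm_num) hm)
  obtain ⟨e⟩ : Nonempty ((κ ⊕ Set κ) ↪ Fin (m + 2 ^ m)) :=
    Function.Embedding.nonempty_of_card_le (by simpa using hcard)
  -- Inside `S` the label is the class; outside it is the set of classes seen, which accounts for `m
  -- + 2 ^ m`. Label `0` stays unused.
  refine ⟨fun x => if x ∈ S then (e (.inl (c x))).succ else
    (e (.inr {i | ∃ x' ∈ S, c x' = i ∧ G.Adj x' x})).succ,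
    fun i j => ∃ a, ∃ T : Set κ, i = (e (.inl a)).succ ∧ j = (e (.inr T)).succ ∧ a ∈ T, ?_, ?_, ?_⟩
  · rintro j ⟨a, T, h, -⟩
    exact Fin.succ_ne_zero _ h.symm
  · rintro j ⟨a, T, -, h, -⟩
    exact Fin.succ_ne_zero _ h.symm
  · intro x hx y hy
    simp only [hx, hy, if_true, if_false]
    constructor
    · exact fun h => ⟨_, _, rfl, rfl, x, hx, rfl, h⟩
    · rintro ⟨a, T, h1, h2, h3⟩
      have h1 := Sum.inl_injective (e.injective (Fin.succ_injective _ h1))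
      have h2 := Sum.inr_injective (e.injective (Fin.succ_injective _ h2))
      subst h1 h2
      obtain ⟨x', hx', hcx, hadj⟩ := h3
      exact hc x' hx' x hx hcx y hy hadj

theorem cutBound_singleton (G : SimpleGraph V) {k : ℕ} (hk : 1 ≤ k) (x : V) :
    CutBound G k {x} := by
  classical
  refine ⟨fun y => if y = x ∨ G.Adj x y then ⟨1, by omega⟩ else 0, fun i j => i.1 = 1 ∧ j.1 = 1,
    by simp, by simp, ?_⟩
  intro a ha y hy
  rw [mem_singleton_iff.1 ha]
  have : y ≠ x := fun h => hy h
  by_cases h : G.Adj x y <;> simp [h, this]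

/-- No cut with at least two vertices on each side has complexity at most one. -/
def SplitFree (G : SimpleGraph V) : Prop :=
  ∀ X A B : Set V, (∀ x ∈ X, ∀ y ∉ X, G.Adj x y ↔ x ∈ A ∧ y ∈ B) →
    X.Subsingleton ∨ Xᶜ.Subsingleton

/-- The marker `b` represents everything beyond the split. Rerooting at `b` leaves a tree on `X`; in
its cuts, outside vertices in `B` look like `b` to all of `X`, and the others see nothing of `X` and
take the reserved label `0`. -/
theorem branchTree_side_of_split (G : SimpleGraph V) {k : ℕ} {X A B : Set V}
    (hX : ∀ x ∈ X, ∀ y ∉ X, G.Adj x y ↔ x ∈ A ∧ y ∈ B) (hX0 : X.Nonempty) {b : V} (hbX : b ∉ X)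
    (hb : b ∈ B ∨ ∀ y ∉ X, y ∉ B)
    (h : BranchTree (CutBound (G.induce (insert b X)) k) univ) :
    BranchTree (CutBound G k) X := by
  classical
  let b' : ↥(insert b X) := ⟨b, mem_insert _ _⟩
  have hr := h.reroot (fun S (hS : CutBound _ k S) => hS.compl) (mem_univ b') (.inl rfl)
  rcases hr with hr | hr
  · obtain ⟨x, hx⟩ := hX0
    have : (⟨x, mem_insert_of_mem _ hx⟩ : ↥(insert b X)) ∈ ({b'} : Set _) := hr.1 ▸ mem_univ _
    have : x = b := congrArg Subtype.val (mem_singleton_iff.1 this)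
    exact (hbX (this ▸ hx)).elim
  have him : (Subtype.val '' ({b'}ᶜ : Set ↥(insert b X))) = X := by
    ext x
    constructor
    · rintro ⟨⟨y, hy⟩, hyb, rfl⟩
      rcases hy with rfl | hy
      · exact (hyb rfl).elim
      · exact hy
    · intro hx
      refine ⟨⟨x, mem_insert_of_mem _ hx⟩, ?_, rfl⟩
      intro h
      have : x = b := congrArg Subtype.val (mem_singleton_iff.1 h)
      exact hbX (this ▸ hx)
  rw [← him]
  refine hr.map _ Subtype.val_injective ?_
  rintro T hT ⟨l, M, h1, h2, h3⟩
  refine ⟨fun v => if h : v ∈ X then l ⟨v, mem_insert_of_mem _ h⟩ else if v ∈ B then l b' else 0,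
    M, h1, h2, ?_⟩
  rintro _ ⟨⟨x, hx'⟩, hxT, rfl⟩ y hy
  have hx : x ∈ X := by
    rcases hx' with rfl | hx
    · exact (hT hxT rfl).elim
    · exact hx
  by_cases hyX : y ∈ X
  · have := h3 _ hxT ⟨y, mem_insert_of_mem _ hyX⟩ fun h => hy ⟨_, h, rfl⟩
    simpa [hx, hyX] using this
  · by_cases hyB : y ∈ B
    · have hbB : b ∈ B := hb.resolve_right fun h => h y hyX hyB
      have := h3 _ hxT b' fun h => hT h rfl
      have e : G.Adj x y ↔ G.Adj x b := by rw [hX x hx y hyX, hX x hx b hbX]; simp [hyB, hbB]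
      simp only [hx, hyX, hyB, dif_pos, dif_neg, if_true, not_false_iff]
      rw [e]
      exact this
    · simp only [hx, hyX, hyB, dif_pos, dif_neg, if_false, not_false_iff, hX x hx y hyX, h2,
        and_false]

/-- A hereditary class of graphs has bounded branch trees as soon as its split-free members do. -/
theorem branchTree_of_splitFree {k : ℕ}
    (C : ∀ {V : Type u}, SimpleGraph V → Prop)
    (hC : ∀ {V : Type u} (G : SimpleGraph V) (s : Set V), C G → C (G.induce s))
    (hbase : ∀ {V : Type u} [Finite V] [Nonempty V] (G : SimpleGraph V), C G → SplitFree G →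
      BranchTree (CutBound G k) univ) :
    ∀ {V : Type u} [Finite V] [Nonempty V] (G : SimpleGraph V), C G →
      BranchTree (CutBound G k) univ := by
  suffices ∀ n : ℕ, ∀ {V : Type u} [Finite V] [Nonempty V] (G : SimpleGraph V), Nat.card V = n →
      C G → BranchTree (CutBound G k) univ from
    fun {V} _ _ G h => this _ G rfl h
  intro n
  induction n using Nat.strong_induction_on with
  | _ n ih =>
  intro V _ _ G hn hG
  by_cases hs : SplitFree G
  · exact hbase G hG hs
  obtain ⟨X, A, B, hX, hX1, hX2⟩ : ∃ X A B : Set V, (∀ x ∈ X, ∀ y ∉ X, G.Adj x y ↔ x ∈ A ∧ y ∈ B) ∧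
      ¬ X.Subsingleton ∧ ¬ Xᶜ.Subsingleton := by
    unfold SplitFree at hs
    push Not at hs
    obtain ⟨X, A, B, h1, h2⟩ := hs
    exact ⟨X, A, B, h1, not_subsingleton_iff.2 h2.1, not_subsingleton_iff.2 h2.2⟩
  have side : ∀ X A B : Set V, (∀ x ∈ X, ∀ y ∉ X, G.Adj x y ↔ x ∈ A ∧ y ∈ B) →
      ¬ X.Subsingleton → ¬ Xᶜ.Subsingleton → BranchTree (CutBound G k) X := by
    intro X A B hX hX1 hX2
    rw [not_subsingleton_iff] at hX1 hX2
    -- The marker must lie in `B` whenever the far side meets `B`, so that it sees `A`.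
    obtain ⟨b, hbX, hb⟩ : ∃ b, b ∉ X ∧ (b ∈ B ∨ ∀ y ∉ X, y ∉ B) := by
      by_cases h : ∃ y ∉ X, y ∈ B
      · obtain ⟨y, hy, hyB⟩ := h
        exact ⟨y, hy, .inl hyB⟩
      · push Not at h
        obtain ⟨y, hy⟩ := hX2.nonempty
        exact ⟨y, hy, .inr h⟩
    refine branchTree_side_of_split G hX hX1.nonempty hbX hb ?_
    have hlt : Nat.card ↥(insert b X) < n := by
      rw [Nat.card_coe_set_eq, ← hn, ← Set.ncard_univ]
      refine Set.ncard_lt_ncard ⟨subset_univ _, fun hu => ?_⟩ (Set.toFinite _)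
      obtain ⟨y, hy, z, hz, hyz⟩ := hX2
      rcases hu (mem_univ y) with rfl | h
      · rcases hu (mem_univ z) with rfl | h
        · exact hyz rfl
        · exact hz h
      · exact hy h
    exact ih _ hlt _ rfl (hC G _ hG)
  have h1 := side X A B hX hX1 hX2
  have h2 := side Xᶜ B A (fun x hx y hy => by
    rw [G.adj_comm, hX y (not_not.1 hy) x hx, and_comm]) hX2 (by rwa [compl_compl])
  rw [← union_compl_self X]
  exact .union _ _ disjoint_compl_right h1 h2 (by rw [union_compl_self]; exact cutBound_univ G k)

/-- A union of components has an edgeless cut, so it or its complement is a single vertex. An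
isolated vertex paired with any other vertex again gives a split, which four vertices make
nontrivial. -/
theorem SplitFree.eq_univ_of_closed {G : SimpleGraph V} (h : SplitFree G) (hc : 4 ≤ Nat.card V)
    {X : Set V} (hX0 : X.Nonempty) (hX : ∀ x ∈ X, ∀ y, G.Adj x y → y ∈ X) : X = univ := by
  have : Finite V := Nat.finite_of_card_ne_zero (by omega)
  by_contra hne
  have two : ∀ Y : Set V, Y.Subsingleton → Yᶜ.Subsingleton → False := by
    intro Y h1 h2
    have := Set.ncard_add_ncard_compl Y
    have h1 := (Set.ncard_le_one_iff_subsingleton (s := Y)).2 h1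
    have h2 := (Set.ncard_le_one_iff_subsingleton (s := Yᶜ)).2 h2
    omega
  have three : ∀ x z : V, ({x, z}ᶜ : Set V).Subsingleton → False := by
    intro x z h2
    have := Set.ncard_add_ncard_compl ({x, z} : Set V)
    have h1 := Set.ncard_insert_le x {z}
    rw [Set.ncard_singleton] at h1
    have h2 := (Set.ncard_le_one_iff_subsingleton (s := ({x, z}ᶜ : Set V))).2 h2
    omega
  have one : ∀ Y : Set V, Y.Subsingleton → Y.Nonempty → (∀ x ∈ Y, ∀ y, G.Adj x y → y ∈ Y) →
      False := by
    rintro Y hY ⟨x, hx⟩ hcl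
    have hYx : Y = {x} := hY.eq_singleton_of_mem hx
    have hYc : ∃ z, z ≠ x := by
      by_contra hz
      push Not at hz
      exact two Y hY fun a ha => (ha (by rw [hYx]; exact hz a)).elim
    obtain ⟨z, hz⟩ := hYc
    have hiso : ∀ y, ¬ G.Adj x y := fun y hy => by
      have := hcl x hx y hy
      rw [hYx] at this
      exact G.ne_of_adj hy this.symm
    rcases h {x, z} {z} {y | G.Adj z y} (by
      rintro a (rfl | rfl) y hy
      · simp [hiso y, hz.symm]
      · simp) with h' | h'
    · exact hz (h' (by simp) (by simp))
    · exact three x z h'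
  rcases h X ∅ ∅ (fun x hx y hy => by
    simp only [mem_empty_iff_false, and_false, iff_false]
    exact fun h => hy (hX x hx y h)) with h' | h'
  · exact one X h' hX0 hX
  · refine one Xᶜ h' (nonempty_compl.2 hne) fun x hx y hxy hy => hx (hX y hy x hxy.symm)

/-- Two twins form one side of a split, joined completely to their common neighbourhood. -/
theorem SplitFree.eq_of_twins {G : SimpleGraph V} (h : SplitFree G) (hc : 4 ≤ Nat.card V) {p q : V}
    (hpq : ∀ y, G.Adj p y ↔ G.Adj q y) : p = q := by
  have : Finite V := Nat.finite_of_card_ne_zero (by omega)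
  by_contra hne
  rcases h {p, q} univ {y | G.Adj p y} (by
      rintro a (rfl | rfl) y hy
      · simp
      · simp [hpq]) with h' | h'
  · exact hne (h' (by simp) (by simp))
  · have := Set.ncard_add_ncard_compl ({p, q} : Set V)
    have h1 := Set.ncard_insert_le p {q}
    rw [Set.ncard_singleton] at h1
    have h2 := (Set.ncard_le_one_iff_subsingleton (s := ({p, q}ᶜ : Set V))).2 h'
    omega

end Split

/-! ### From trees of cuts to clique-width expressions. -/

namespace CliqueWidthExpr

variable {K : ℕ}

/-- Simultaneous renaming of labels, provided no renamed label is a target. -/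
theorem exists_relabel (e : CliqueWidthExpr K) (f : Fin K → Fin K) (D : Finset (Fin K))
    (hD : ∀ d ∈ D, f d ∉ D) :
    ∃ e' : CliqueWidthExpr K, ∃ φ : e.graph ≃g e'.graph,
      ∀ x, e'.label (φ x) = if e.label x ∈ D then f (e.label x) else e.label x := by
  induction D using Finset.induction_on with
  | empty => exact ⟨e, .refl, fun x => by simp⟩
  | insert a D ha ih =>
    obtain ⟨e', φ, h⟩ := ih fun d hd h => hD d (Finset.mem_insert_of_mem hd)
      (Finset.mem_insert_of_mem h)
    refine ⟨relabel a (f a) e', φ, fun x => ?_⟩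
    change (if e'.label (φ x) = a then f a else e'.label (φ x)) = _
    rw [h x]
    by_cases h1 : e.label x = a
    · simp [h1, ha]
    · by_cases h2 : e.label x ∈ D
      · have : f (e.label x) ≠ a := fun h => hD _ (Finset.mem_insert_of_mem h2)
          (h ▸ Finset.mem_insert_self _ _)
        simp [h2, this]
      · simp [h1, h2]

/-- Adding the edges between several pairs of labels. -/
theorem exists_join (e : CliqueWidthExpr K) (J : Finset (Fin K × Fin K))
    (hJ : ∀ p ∈ J, p.1 ≠ p.2) :
    ∃ e' : CliqueWidthExpr K, ∃ φ : e.Vert ≃ e'.Vert,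
      (∀ x, e'.label (φ x) = e.label x) ∧ ∀ x y, e'.graph.Adj (φ x) (φ y) ↔ e.graph.Adj x y ∨
        (e.label x, e.label y) ∈ J ∨ (e.label y, e.label x) ∈ J := by
  induction J using Finset.induction_on with
  | empty => exact ⟨e, .refl _, fun x => rfl, fun x y => by simp⟩
  | insert p J hp ih =>
    obtain ⟨e', φ, h1, h2⟩ := ih fun q hq => hJ q (Finset.mem_insert_of_mem hq)
    have hne := hJ p (Finset.mem_insert_self _ _)
    refine ⟨join p.1 p.2 hne e', φ, h1, fun x y => ?_⟩
    change e'.graph.Adj (φ x) (φ y) ∨ (SimpleGraph.fromRel (fun a b : e'.Vert =>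
      e'.label a = p.1 ∧ e'.label b = p.2)).Adj (φ x) (φ y) ↔ _
    rw [h2, SimpleGraph.fromRel_adj, h1, h1, Finset.mem_insert, Finset.mem_insert, Prod.ext_iff,
      Prod.ext_iff]
    have : e.label x = p.1 ∧ e.label y = p.2 ∨ e.label y = p.1 ∧ e.label x = p.2 →
        φ x ≠ φ y := by
      intro h hxy
      rw [φ.injective hxy] at h
      rcases h with ⟨h, h'⟩ | ⟨h, h'⟩ <;> exact hne (h ▸ h')
    tauto

end CliqueWidthExpr

section

open Set

open CliqueWidthExpr

variable {V : Type*}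

/-- The graph induced by `S` is built by an expression with `3 * n` labels which finally uses only
the labels less than `n`, and vertices with the same label have the same neighbours
outside `S`. -/
def BuiltOn (G : SimpleGraph V) (n : ℕ) (S : Set V) : Prop :=
  ∃ (e : CliqueWidthExpr (3 * n)) (φ : G.induce S ≃g e.graph) (l : V → Fin n),
    (∀ x : S, (e.label (φ x)).1 = (l x).1) ∧
    ∀ x ∈ S, ∀ x' ∈ S, l x = l x' → ∀ y ∉ S, G.Adj x y → G.Adj x' y

theorem BuiltOn.cliqueWidth_le {G : SimpleGraph V} {n : ℕ} (h : BuiltOn G n univ) :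
    cliqueWidth G ≤ (3 * n : ℕ) := by
  obtain ⟨e, φ, -⟩ := h
  refine iInf₂_le (3 * n) ⟨e, ⟨?_⟩⟩
  exact (SimpleGraph.induceUnivIso G).symm.trans φ

theorem builtOn_singleton (G : SimpleGraph V) {n : ℕ} (hn : 0 < n) (x : V) :
    BuiltOn G n {x} := by
  refine ⟨vertex ⟨0, by omega⟩, ⟨⟨fun _ => (), fun _ => ⟨x, rfl⟩, ?_, ?_⟩, ?_⟩, fun _ => ⟨0, hn⟩,
    fun _ => rfl, ?_⟩
  · rintro ⟨y, rfl⟩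
    rfl
  · intro y
    rfl
  · rintro ⟨a, rfl⟩ ⟨b, hb⟩
    obtain rfl := mem_singleton_iff.1 hb
    simp only [SimpleGraph.irrefl]
  · intro a ha b hb _ y _ h
    rwa [mem_singleton_iff.1 ha, ← mem_singleton_iff.1 hb] at *

/-- The `3 * n` labels form three banks: one for `S`, one for a shifted copy of the labels of `T`,
and one as scratch space for renaming. Equally labelled vertices of `S` agree outside `S`, and
likewise for `T`, so the cross edges can be added by label pairs. -/
theorem BuiltOn.union {G : SimpleGraph V} {n : ℕ} {S T : Set V} (hd : Disjoint S T)
    (hS : BuiltOn G n S) (hT : BuiltOn G n T) (l : V → Fin n)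
    (hl : ∀ x ∈ S ∪ T, ∀ x' ∈ S ∪ T, l x = l x' → ∀ y ∉ S ∪ T, G.Adj x y → G.Adj x' y) :
    BuiltOn G n (S ∪ T) := by
  classical
  obtain ⟨e₁, φ₁, l₁, h₁, hom₁⟩ := hS
  obtain ⟨e₂, φ₂, l₂, h₂, hom₂⟩ := hT
  -- An old label class need not be constant under `l`; the whole class receives the `l`-label of
  -- one representative, which has the same outside neighbours.
  have hrep : ∀ (S : Set V) (l₁ : V → Fin n), ∃ f : Fin n → Fin n,
      ∀ x ∈ S, ∃ r ∈ S, l₁ r = l₁ x ∧ f (l₁ x) = l r := by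
    intro S l₁
    have : ∀ i, ∃ j, ∀ x ∈ S, l₁ x = i → ∃ r ∈ S, l₁ r = l₁ x ∧ j = l r := by
      intro i
      by_cases h : ∃ x ∈ S, l₁ x = i
      · obtain ⟨r, hr, hri⟩ := h
        exact ⟨l r, fun x hx hxi => ⟨r, hr, hri.trans hxi.symm, rfl⟩⟩
      · exact ⟨i, fun x hx hxi => (h ⟨x, hx, hxi⟩).elim⟩
    choose f hf using this
    exact ⟨f, fun x hx => hf _ x hx rfl⟩
  obtain ⟨f₁, hf₁⟩ := hrep S l₁
  obtain ⟨f₂, hf₂⟩ := hrep T l₂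
  -- shift the labels of the second expression
  obtain ⟨e₃, φ₃, h₃⟩ := e₂.exists_relabel
    (fun i => if h : i.1 < n then ⟨i.1 + n, by omega⟩ else i) {i | i.1 < n}
    (by
      intro d hd
      have hd : d.1 < n := by simpa using hd
      simp [hd])
  have hlab₃ : ∀ y : T, (e₃.label (φ₃ (φ₂ y))).1 = (l₂ y).1 + n := by
    intro y
    have h1 := h₂ y
    have h2 := (l₂ y).2
    rw [h₃]
    simp [h1]
  -- add the edges between the two sides
  obtain ⟨e₄, φ₄, h₄, hadj₄⟩ := (CliqueWidthExpr.union e₁ e₃).exists_join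
    {p | ∃ x ∈ S, ∃ y ∈ T, p.1.1 = (l₁ x).1 ∧ p.2.1 = (l₂ y).1 + n ∧ G.Adj x y}
    (by
      intro p hp
      obtain ⟨x, hx, y, hy, h1, h2, -⟩ : ∃ x ∈ S, ∃ y ∈ T, p.1.1 = (l₁ x).1 ∧
        p.2.1 = (l₂ y).1 + n ∧ G.Adj x y := by simpa using hp
      intro h
      rw [h, h2] at h1
      have := (l₁ x).2
      omega)
  -- rename to the labels of the union
  obtain ⟨e₅, φ₅, h₅⟩ := e₄.exists_relabel
    (fun i => if h : i.1 < n then ⟨f₁ ⟨i.1, h⟩ + 2 * n, by omega⟩ else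
      if h : i.1 - n < n then ⟨f₂ ⟨i.1 - n, h⟩ + 2 * n, by omega⟩ else i) {i | i.1 < 2 * n}
    (by
      intro d hd
      have hd : d.1 < 2 * n := by simpa using hd
      have hd' : d.1 - n < n := by omega
      by_cases h : d.1 < n <;> simp [h, hd'])
  -- The new labels were parked in the third bank because simultaneous renaming needs targets
  -- outside its domain; they now return to the first.
  obtain ⟨e₆, φ₆, h₆⟩ := e₅.exists_relabel
    (fun i => if h : 2 * n ≤ i.1 then ⟨i.1 - 2 * n, by omega⟩ else i) {i | 2 * n ≤ i.1}
    (by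
      intro d hd
      have hd : 2 * n ≤ d.1 := by simpa using hd
      simp [hd]
      omega)
  let ψ : S ⊕ T ≃ e₄.Vert :=
    (Equiv.sumCongr φ₁.toEquiv (φ₂.toEquiv.trans φ₃.toEquiv) :
      S ⊕ T ≃ (CliqueWidthExpr.union e₁ e₃).Vert).trans φ₄
  have hψl : ∀ x : S, (e₄.label (ψ (.inl x))).1 = (l₁ x).1 := fun x =>
    (congrArg Fin.val (h₄ _)).trans (h₁ x)
  have hψr : ∀ y : T, (e₄.label (ψ (.inr y))).1 = (l₂ y).1 + n := fun y =>
    (congrArg Fin.val (h₄ _)).trans (hlab₃ y)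
  have hcross : ∀ (x : S) (y : T), e₄.graph.Adj (ψ (.inl x)) (ψ (.inr y)) ↔ G.Adj x y := by
    intro x y
    refine (hadj₄ _ _).trans ?_
    have a1 : (CliqueWidthExpr.label (.union e₁ e₃) (.inl (φ₁ x))).1 = (l₁ x).1 := h₁ x
    have a2 : (CliqueWidthExpr.label (.union e₁ e₃) (.inr (φ₃ (φ₂ y)))).1 = (l₂ y).1 + n :=
      hlab₃ y
    have a3 : ¬ (CliqueWidthExpr.union e₁ e₃).graph.Adj (.inl (φ₁ x)) (.inr (φ₃ (φ₂ y))) := by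
      intro h
      cases h
    have b1 := (l₁ x).2
    constructor
    · rintro (h | h | h)
      · exact (a3 h).elim
      · obtain ⟨x', hx', y', hy', h1, h2, h3⟩ := (Finset.mem_filter.1 h).2
        have h1 := a1.symm.trans h1
        have h2 := a2.symm.trans h2
        have h4 := hom₁ x' hx' x x.2 (Fin.ext h1.symm) y' (disjoint_right.1 hd hy') h3
        exact (hom₂ y' hy' y y.2 (Fin.ext (by omega)) x (disjoint_left.1 hd x.2) h4.symm).symm
      · obtain ⟨x', hx', y', hy', h1, h2, h3⟩ := (Finset.mem_filter.1 h).2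
        have h1 := a2.symm.trans h1
        have := (l₁ x').2
        omega
    · intro h
      exact .inr (.inl (Finset.mem_filter.2 ⟨Finset.mem_univ _, x, x.2, y, y.2, a1, a2, h⟩))
  have hleft : ∀ x x' : S, e₄.graph.Adj (ψ (.inl x)) (ψ (.inl x')) ↔ G.Adj x x' := by
    intro x x'
    refine (hadj₄ _ _).trans ?_
    have a1 : ∀ x, (CliqueWidthExpr.label (.union e₁ e₃) (.inl (φ₁ x))).1 = (l₁ x).1 := h₁
    have hno : ∀ x x' : S, ¬ ∃ a ∈ S, ∃ y ∈ T,
        (CliqueWidthExpr.label (.union e₁ e₃) (.inl (φ₁ x))).1 = (l₁ a).1 ∧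
        (CliqueWidthExpr.label (.union e₁ e₃) (.inl (φ₁ x'))).1 = (l₂ y).1 + n ∧ G.Adj a y := by
      rintro x x' ⟨a, -, y, -, -, h, -⟩
      have := a1 x' ▸ h
      have := (l₁ x').2
      omega
    constructor
    · rintro (h | h | h)
      · exact φ₁.map_rel_iff.1 h
      · exact (hno x x' (Finset.mem_filter.1 h).2).elim
      · exact (hno x' x (Finset.mem_filter.1 h).2).elim
    · exact fun h => .inl (φ₁.map_rel_iff.2 h)
  have hright : ∀ y y' : T, e₄.graph.Adj (ψ (.inr y)) (ψ (.inr y')) ↔ G.Adj y y' := by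
    intro x x'
    refine (hadj₄ _ _).trans ?_
    have a1 : ∀ x, (CliqueWidthExpr.label (.union e₁ e₃) (.inr (φ₃ (φ₂ x)))).1 =
      (l₂ x).1 + n := hlab₃
    have hno : ∀ x x' : T, ¬ ∃ a ∈ S, ∃ y ∈ T,
        (CliqueWidthExpr.label (.union e₁ e₃) (.inr (φ₃ (φ₂ x)))).1 = (l₁ a).1 ∧
        (CliqueWidthExpr.label (.union e₁ e₃) (.inr (φ₃ (φ₂ x')))).1 = (l₂ y).1 + n ∧
        G.Adj a y := by
      rintro x x' ⟨a, -, y, -, h, -, -⟩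
      have := a1 x ▸ h
      have := (l₁ a).2
      omega
    constructor
    · rintro (h | h | h)
      · exact φ₂.map_rel_iff.1 (φ₃.map_rel_iff.1 h)
      · exact (hno x x' (Finset.mem_filter.1 h).2).elim
      · exact (hno x' x (Finset.mem_filter.1 h).2).elim
    · exact fun h => .inl (φ₃.map_rel_iff.2 (φ₂.map_rel_iff.2 h))
  let σ : ↥(S ∪ T) ≃ S ⊕ T := Equiv.Set.union hd
  have hσl : ∀ x (h : x ∈ S), σ ⟨x, .inl h⟩ = .inl ⟨x, h⟩ := fun x h =>
    Equiv.Set.union_apply_left hd h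
  have hσr : ∀ x (h : x ∈ T), σ ⟨x, .inr h⟩ = .inr ⟨x, h⟩ := fun x h =>
    Equiv.Set.union_apply_right hd h
  let φ : G.induce (S ∪ T) ≃g e₄.graph :=
    { toEquiv := σ.trans ψ
      map_rel_iff' := by
        rintro ⟨x, hx | hx⟩ ⟨y, hy | hy⟩
        · simp only [Equiv.trans_apply, hσl _ hx, hσl _ hy, hleft, SimpleGraph.induce_adj]
        · simp only [Equiv.trans_apply, hσl _ hx, hσr _ hy, hcross, SimpleGraph.induce_adj]
        · rw [G.induce_adj, G.adj_comm, SimpleGraph.adj_comm]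
          simp only [Equiv.trans_apply, hσr _ hx, hσl _ hy, hcross]
        · simp only [Equiv.trans_apply, hσr _ hx, hσr _ hy, hright, SimpleGraph.induce_adj] }
  refine ⟨e₆, (φ.trans φ₅).trans φ₆, fun v => if v ∈ S then f₁ (l₁ v) else f₂ (l₂ v), ?_, ?_⟩
  · rintro ⟨x, hx⟩
    change (e₆.label (φ₆ (φ₅ (φ ⟨x, hx⟩)))).1 = _
    rw [h₆, h₅]
    by_cases hxS : x ∈ S
    · have a1 : (e₄.label (φ ⟨x, hx⟩)).1 = (l₁ x).1 := by
        rw [← hψl ⟨x, hxS⟩, ← hσl x hxS]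
        rfl
      have a2 := (l₁ x).2
      have a3 : (l₁ x).1 < 2 * n := by omega
      simp [a1, a2, a3, hxS]
    · have hxT : x ∈ T := hx.resolve_left hxS
      have a1 : (e₄.label (φ ⟨x, hx⟩)).1 = (l₂ x).1 + n := by
        rw [← hψr ⟨x, hxT⟩, ← hσr x hxT]
        rfl
      have a2 := (l₂ x).2
      have a3 : (l₂ x).1 + n < 2 * n := by omega
      simp [a1, a2, a3, hxS]
  · have hr : ∀ x ∈ S ∪ T, ∃ r ∈ S ∪ T, (if x ∈ S then f₁ (l₁ x) else f₂ (l₂ x)) = l r ∧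
        ∀ y ∉ S ∪ T, G.Adj x y ↔ G.Adj r y := by
      intro x hx
      by_cases hxS : x ∈ S
      · obtain ⟨r, hr, h1, h2⟩ := hf₁ x hxS
        refine ⟨r, .inl hr, by simp [hxS, h2], fun y hy => ?_⟩
        have hy : y ∉ S := fun h => hy (.inl h)
        exact ⟨hom₁ x hxS r hr h1.symm y hy, hom₁ r hr x hxS h1 y hy⟩
      · have hxT : x ∈ T := hx.resolve_left hxS
        obtain ⟨r, hr, h1, h2⟩ := hf₂ x hxT
        refine ⟨r, .inr hr, by simp [hxS, h2], fun y hy => ?_⟩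
        have hy : y ∉ T := fun h => hy (.inr h)
        exact ⟨hom₂ x hxT r hr h1.symm y hy, hom₂ r hr x hxT h1 y hy⟩
    intro x hx x' hx' hxx y hy h
    obtain ⟨r, hrm, h1, h2⟩ := hr x hx
    obtain ⟨r', hrm', h1', h2'⟩ := hr x' hx'
    rw [h2' y hy]
    exact hl r hrm r' hrm' (by rw [← h1, ← h1']; exact hxx) y hy ((h2 y hy).1 h)

theorem builtOn_of_branchTree {G : SimpleGraph V} {k : ℕ} {S : Set V}
    (h : BranchTree (CutBound G k) S) : BuiltOn G (k + 1) S := by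
  induction h with
  | single x _ => exact builtOn_singleton G (by omega) x
  | union S T hd _ _ hP ihS ihT =>
    obtain ⟨l, M, -, -, hM⟩ := hP
    refine ihS.union hd ihT l fun x hx x' hx' hxx y hy => ?_
    rw [hM x hx y hy, hM x' hx' y hy, hxx]
    exact id

end

/-! ### Linear layouts and block structures. -/

section Layout

open Set

variable {V : Type*}

/-- A linear layout all of whose prefixes have few neighbourhood classes gives a bounded branch
tree. -/
theorem branchTree_of_layout [Finite V] [Nonempty V] (G : SimpleGraph V) {κ : Type*} [Fintype κ]
    {m : ℕ} (hm : Fintype.card κ ≤ m) (f : V → ℕ) (hf : Function.Injective f)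
    (hc : ∀ n, ∃ c : V → κ, ∀ x x', f x < n → f x' < n → c x = c x' → ∀ y, n ≤ f y →
      G.Adj x y → G.Adj x' y) :
    BranchTree (CutBound G (m + 2 ^ m)) univ := by
  have hcut : ∀ n, CutBound G (m + 2 ^ m) {v | f v < n} := fun n => by
    obtain ⟨c, h⟩ := hc n
    exact cutBound_of_classes G hm _ c fun x hx x' hx' hxx y hy =>
      h x x' hx hx' hxx y (not_lt.1 hy)
  -- The prefixes form a caterpillar tree; the empty prefix is set apart because trees are nonempty.
  have key : ∀ n, {v | f v < n} = ∅ ∨ BranchTree (CutBound G (m + 2 ^ m)) {v | f v < n} := by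
    intro n
    induction n with
    | zero => left; simp
    | succ n ih =>
      by_cases hv : ∃ v, f v = n
      · obtain ⟨v, hv⟩ := hv
        have hs : BranchTree (CutBound G (m + 2 ^ m)) {v} :=
          .single v (cutBound_singleton G (by have := Nat.one_le_two_pow (n := m); omega) v)
        have e : {w | f w < n + 1} = {w | f w < n} ∪ {v} := by
          ext w
          simp only [mem_ofPred_eq, mem_union, mem_singleton_iff]
          constructor
          · intro h
            by_cases hw : f w = n
            · exact .inr (hf (hw.trans hv.symm))
            · left; omega
          · rintro (h | rfl) <;> omega
        right
        have hP := hcut (n + 1)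
        rcases ih with ih | ih
        · rw [e, ih, empty_union]
          exact hs
        · rw [e] at hP ⊢
          refine .union _ _ ?_ ih hs hP
          rw [disjoint_singleton_right]
          simp [hv]
      · have e : {w | f w < n + 1} = {w | f w < n} := by
          ext w
          have : f w ≠ n := fun h => hv ⟨w, h⟩
          simp only [mem_ofPred_eq]
          omega
        rw [e]
        exact ih
  obtain ⟨N, hN⟩ := (Set.finite_range f).bddAbove
  have e : {v | f v < N + 1} = univ := eq_univ_of_forall fun v =>
    Nat.lt_succ_of_le (hN (mem_range_self v))
  have := key (N + 1)
  rw [e] at this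
  exact this.resolve_left univ_nonempty.ne_empty

/-- The transitive closure extends to a well-order, and a vertex is numbered by counting its
predecessors. -/
theorem exists_injective_nat_of_acyclic [Finite V] (r : V → V → Prop)
    (hr : ∀ a, ¬ Relation.TransGen r a a) :
    ∃ f : V → ℕ, Function.Injective f ∧ ∀ a b, r a b → f a < f b := by
  have : Std.Irrefl (Relation.TransGen r) := ⟨hr⟩
  have wf : WellFounded (Relation.TransGen r) := Finite.wellFounded_of_trans_of_irrefl _
  have : IsWellFounded V (Relation.TransGen r) := ⟨wf⟩
  obtain ⟨s, hs, hwo⟩ := IsWellFounded.exists_well_order_ge (Relation.TransGen r)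
  have hfin : ∀ a, {b | s b a}.Finite := fun a => Set.toFinite _
  have hlt : ∀ a b, s a b → {c | s c a}.ncard < {c | s c b}.ncard := fun a b hab =>
    Set.ncard_lt_ncard ⟨fun c hc => _root_.trans (r := s) hc hab, fun h => irrefl_of s a (h hab)⟩ (hfin b)
  refine ⟨fun a => {b | s b a}.ncard, fun a b hab => ?_, fun a b hab =>
    hlt a b (hs _ _ (.single hab))⟩
  rcases trichotomous_of s a b with h | h | h
  · exact absurd hab (hlt a b h).ne
  · exact h
  · exact absurd hab (hlt b a h).ne'

/-- A multipartite tournament (with parts the fibres of `c`) without directed triangles, and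
without directed cycles of length four between two parts, is acyclic. -/
theorem multipartite_acyclic {κ : Type*} (c : V → κ) (r : V → V → Prop)
    (hne : ∀ a b, r a b → c a ≠ c b) (hasymm : ∀ a b, r a b → ¬ r b a)
    (htot : ∀ a b, c a ≠ c b → r a b ∨ r b a)
    (h3 : ∀ a b d, r a b → r b d → c a ≠ c d → r a d)
    (h4 : ∀ a b a' b', c a = c a' → c b = c b' → r a b → r b a' → r a' b' → ¬ r b' a) (a : V) :
    ¬ Relation.TransGen r a a := by
  -- Directed walks shorten to one arc, or to two arcs when the ends share a part.
  have key : ∀ a b, Relation.TransGen r a b → r a b ∨ c a = c b ∧ ∃ u, r a u ∧ r u b := by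
    intro a b h
    induction h with
    | single h => exact .inl h
    | @tail b d _ hbd ih =>
      rcases ih with hab | ⟨hcab, u, hau, hub⟩
      · by_cases hc : c a = c d
        · exact .inr ⟨hc, b, hab, hbd⟩
        · exact .inl (h3 a b d hab hbd hc)
      · left
        have hcad : c a ≠ c d := hcab ▸ hne b d hbd
        refine (htot a d hcad).resolve_right fun hda => ?_
        by_cases hud : c u = c d
        · exact h4 a u b d hcab hud hau hub hbd hda
        · exact hasymm u d (h3 u b d hub hbd hud) (h3 d a u hda hau (Ne.symm hud))
  intro h
  rcases key a a h with h | ⟨-, u, h1, h2⟩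
  · exact hne a a h rfl
  · exact hasymm a u h1 h2

/-- A layout listing the blocks one after another and sorting each block: within a block the three
kinds of vertices interact through the relation `D`, whose restriction to two kinds is a chain
graph. -/
theorem exists_block_layout [Finite V] {ι : Type*} (blk : V → ι) (kind : V → Fin 3)
    (D : V → V → Prop) (hsymm : ∀ a b, D a b → D b a)
    (h2 : ∀ x x' y y', blk x = blk x' → blk x = blk y → blk x = blk y' → kind x = kind x' →
      kind y = kind y' → kind x ≠ kind y → D x y → D x' y' → D x y' ∨ D x' y)
    (h3 : ∀ x w y, blk x = blk w → blk x = blk y → kind x = 0 → kind w = 1 → kind y = 2 →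
      (D x w → D w y → D x y) ∧ (¬ D x w → ¬ D w y → ¬ D x y)) :
    ∃ f : V → ℕ, Function.Injective f ∧
      (∀ a b c, blk a = blk c → f a < f b → f b < f c → blk b = blk a) ∧
      ∀ a b, blk a = blk b → f a < f b → kind a ≠ kind b → (D a b ↔ kind a < kind b) := by
  -- A pair in `D` points from the smaller kind to the larger, any other pair of different kinds the
  -- opposite way. In an order extending `r`, being in `D` then means being sorted by kind. `h3`
  -- excludes directed triangles and `h2` directed four-cycles.
  let r : V → V → Prop := fun a b => blk a = blk b ∧
    (kind a < kind b ∧ D a b ∨ kind b < kind a ∧ ¬ D a b)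
  -- one block at a time
  have hblock : ∀ i : ι, ∃ f : {v // blk v = i} → ℕ, Function.Injective f ∧
      ∀ a b : {v // blk v = i}, r a b → f a < f b := by
    intro i
    refine exists_injective_nat_of_acyclic (fun a b : {v // blk v = i} => r a b) ?_
    have hb : ∀ a b : {v // blk v = i}, blk a = blk b := fun a b => a.2.trans b.2.symm
    refine multipartite_acyclic (fun a : {v // blk v = i} => kind a) _ ?_ ?_ ?_ ?_ ?_
    · rintro a b ⟨-, ⟨h, -⟩ | ⟨h, -⟩⟩
      · exact h.ne
      · exact h.ne'
    · rintro a b ⟨-, ⟨h, hD⟩ | ⟨h, hD⟩⟩ ⟨-, ⟨h', hD'⟩ | ⟨h', hD'⟩⟩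
      · exact h.not_gt h'
      · exact hD' (hsymm _ _ hD)
      · exact hD (hsymm _ _ hD')
      · exact h.not_gt h'
    · intro a b hab
      by_cases hD : D a b
      · rcases lt_or_gt_of_ne hab with h | h
        · exact .inl ⟨hb a b, .inl ⟨h, hD⟩⟩
        · exact .inr ⟨hb b a, .inl ⟨h, hsymm _ _ hD⟩⟩
      · have hD' : ¬ D b a := fun h => hD (hsymm _ _ h)
        rcases lt_or_gt_of_ne hab with h | h
        · exact .inr ⟨hb b a, .inr ⟨h, hD'⟩⟩
        · exact .inl ⟨hb a b, .inr ⟨h, hD⟩⟩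
    · rintro a b d ⟨-, hab⟩ ⟨-, hbd⟩ had
      have had : kind a ≠ kind d := had
      refine ⟨hb a d, ?_⟩
      have e1 := h3 a b d (hb _ _) (hb _ _)
      have e2 := h3 a d b (hb _ _) (hb _ _)
      have e3 := h3 b a d (hb _ _) (hb _ _)
      have e4 := h3 b d a (hb _ _) (hb _ _)
      have e5 := h3 d a b (hb _ _) (hb _ _)
      have e6 := h3 d b a (hb _ _) (hb _ _)
      have s1 := hsymm a b
      have s2 := hsymm b a
      have s3 := hsymm b d
      have s4 := hsymm d b
      have s5 := hsymm a d
      have s6 := hsymm d a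
      clear hb h2 h3
      have hk : ∀ k : Fin 3, k = 0 ∨ k = 1 ∨ k = 2 := by decide
      rcases hk (kind a) with ha | ha | ha <;> rcases hk (kind b) with hb | hb | hb <;>
        rcases hk (kind d) with hd | hd | hd <;>
        simp only [ha, hb, hd, Fin.isValue, ne_eq, not_true_eq_false, lt_self_iff_false,
          false_and, or_self] at had hab hbd <;>
        simp [ha, hb, hd] at e1 e2 e3 e4 e5 e6 hab hbd ⊢ <;> tauto
    · rintro a b a' b' ha hb' ⟨-, hab⟩ ⟨-, hba'⟩ ⟨-, ha'b'⟩ ⟨-, hb'a⟩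
      have ha : kind a = kind a' := ha
      have hb' : kind b = kind b' := hb'
      rw [← ha] at hba'
      rw [← ha, ← hb'] at ha'b'
      rw [← hb'] at hb'a
      rcases hab with ⟨hk, hab⟩ | ⟨hk, hab⟩ <;>
        simp only [hk, hk.not_gt, true_and, false_and, or_false, false_or] at hba' ha'b' hb'a
      · rcases h2 a a' b b' (hb _ _) (hb _ _) (hb _ _) ha hb' hk.ne hab ha'b' with h | h
        · exact hb'a (hsymm _ _ h)
        · exact hba' (hsymm _ _ h)
      · rcases h2 a a' b' b (hb _ _) (hb _ _) (hb _ _) ha hb'.symm (hb' ▸ hk.ne')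
          (hsymm _ _ hb'a) (hsymm _ _ hba') with h | h
        · exact hab h
        · exact ha'b' h
  choose f hf hfr using hblock
  let F : V → ℕ := fun v => f (blk v) ⟨v, rfl⟩
  have hF : ∀ i (a : {v // blk v = i}), f i a = F a := by
    rintro _ ⟨a, rfl⟩
    rfl
  obtain ⟨N, hN⟩ := (Set.finite_range F).bddAbove
  have hN : ∀ v, F v ≤ N := fun v => hN (mem_range_self v)
  obtain ⟨n, ⟨e⟩⟩ := finite_iff_exists_equiv_fin.1 (Set.finite_range blk)
  let β : V → ℕ := fun v => (e ⟨blk v, mem_range_self v⟩).1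
  have hβ : ∀ a b, β a = β b ↔ blk a = blk b := by
    intro a b
    simp only [β, Fin.val_inj, e.apply_eq_iff_eq, Subtype.mk.injEq]
  have hlt : ∀ a b, β a < β b → β a * (N + 1) + F a < β b * (N + 1) + F b := by
    intro a b hab
    have h1 : (β a + 1) * (N + 1) ≤ β b * (N + 1) := Nat.mul_le_mul_right _ hab
    have h2 := hN a
    nlinarith
  have hFinj : ∀ a b, blk a = blk b → F a = F b → a = b := by
    intro a b hab h
    have := hF (blk b) ⟨a, hab⟩
    have h' := hf (blk b) (a₁ := ⟨a, hab⟩) (a₂ := ⟨b, rfl⟩) (by rw [hF, hF]; exact h)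
    exact congrArg Subtype.val h'
  -- As `F v ≤ N`, this order is lexicographic: by block, then by position within the block.
  refine ⟨fun v => β v * (N + 1) + F v, fun a b hab => ?_, fun a b c hac hab hbc => ?_,
    fun a b hab hlt' hk => ?_⟩
  · have hab : β a * (N + 1) + F a = β b * (N + 1) + F b := hab
    have hβab : β a = β b := by
      rcases lt_trichotomy (β a) (β b) with h | h | h
      · exact absurd hab (hlt _ _ h).ne
      · exact h
      · exact absurd hab (hlt _ _ h).ne'
    exact hFinj a b ((hβ _ _).1 hβab) (by rw [hβab] at hab; omega)
  · have hac := (hβ _ _).2 hac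
    refine (hβ _ _).1 (le_antisymm ?_ ?_) <;> by_contra h
    · have := hlt c b (by omega)
      dsimp only at hbc
      omega
    · have := hlt b a (by omega)
      dsimp only at hab
      omega
  · have hlt' : β a * (N + 1) + F a < β b * (N + 1) + F b := hlt'
    rw [(hβ _ _).2 hab] at hlt'
    have hFlt : ¬ F b < F a := by omega
    have hr : ¬ r b a := fun h => hFlt (by
      have := hfr (blk a) ⟨b, hab.symm⟩ ⟨a, rfl⟩ h
      rwa [hF, hF] at this)
    constructor
    · intro hD
      refine (lt_or_gt_of_ne hk).resolve_right fun h => hr ⟨hab.symm, .inl ⟨h, hsymm _ _ hD⟩⟩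
    · intro h
      by_contra hD
      exact hr ⟨hab.symm, .inr ⟨h, fun h' => hD (hsymm _ _ h')⟩⟩

/-- A graph whose adjacency is determined by boundedly many vertex types, up to flipping the pairs
in `D`, where `D` lives inside blocks and is chain-like there. -/
theorem branchTree_of_blocks [Finite V] [Nonempty V] (G : SimpleGraph V) {ι κ : Type*} [Fintype κ]
    {m : ℕ} (hm : Fintype.card (κ × Fin 3 × Bool) ≤ m) (blk : V → ι) (kind : V → Fin 3) (τ : V → κ)
    (D : V → V → Prop) (β : κ → κ → Prop) (hsymm : ∀ a b, D a b → D b a)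
    (hD : ∀ a b, D a b → blk a = blk b ∧ kind a ≠ kind b)
    (h2 : ∀ x x' y y', blk x = blk x' → blk x = blk y → blk x = blk y' → kind x = kind x' →
      kind y = kind y' → kind x ≠ kind y → D x y → D x' y' → D x y' ∨ D x' y)
    (h3 : ∀ x w y, blk x = blk w → blk x = blk y → kind x = 0 → kind w = 1 → kind y = 2 →
      (D x w → D w y → D x y) ∧ (¬ D x w → ¬ D w y → ¬ D x y))
    (hG : ∀ a b, a ≠ b → (G.Adj a b ↔ (β (τ a) (τ b) ↔ ¬ D a b))) :
    BranchTree (CutBound G (m + 2 ^ m)) univ := by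
  classical
  obtain ⟨f, hf, hfb, hfD⟩ := exists_block_layout blk kind D hsymm h2 h3
  refine branchTree_of_layout G hm f hf fun n => ?_
  -- Blocks are intervals, so a prefix cuts at most one of them; the flag tells whether `x` lies in
  -- that block.
  refine ⟨fun x => (τ x, kind x, decide (∃ y, n ≤ f y ∧ blk x = blk y)), ?_⟩
  intro x x' hx hx' hxx y hy
  simp only [Prod.mk.injEq, decide_eq_decide] at hxx
  obtain ⟨hτ, hk, hflag⟩ := hxx
  have hDiff : ∀ x, f x < n → (D x y ↔ blk x = blk y ∧ kind x < kind y) := by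
    intro x hx
    constructor
    · intro h
      obtain ⟨h1, h2⟩ := hD _ _ h
      exact ⟨h1, (hfD x y h1 (by omega) h2).1 h⟩
    · rintro ⟨h1, h2⟩
      exact (hfD x y h1 (by omega) h2.ne).2 h2
  have hblk : ∀ x x', f x < n → f x' < n → (∃ y, n ≤ f y ∧ blk x' = blk y) → blk x = blk y →
      blk x' = blk y := by
    rintro x x' hx hx' ⟨y', hy', hb'⟩ hb
    rcases lt_trichotomy (f x) (f x') with h | h | h
    · rw [hfb x x' y hb h (by omega), hb]
    · rw [← hf h, hb]
    · rw [← hb, hfb x' x y' hb' h (by omega)]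
  have hblk' : blk x = blk y ↔ blk x' = blk y :=
    ⟨fun h => hblk x x' hx hx' (hflag.1 ⟨y, hy, h⟩) h,
      fun h => hblk x' x hx' hx (hflag.2 ⟨y, hy, h⟩) h⟩
  have hne : x ≠ y := by rintro rfl; omega
  have hne' : x' ≠ y := by rintro rfl; omega
  rw [hG x y hne, hG x' y hne', hDiff x hx, hDiff x' hx', hτ, hk, hblk']
  exact id

/-- The previous criterion with boundedly many exceptional vertices. -/
theorem branchTree_of_blocks_of_exceptions [Finite V] [Nonempty V] (G : SimpleGraph V)
    {ι κ : Type*} [Fintype κ] (F : Set V) {s m : ℕ} (hF : F.ncard ≤ s)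
    (hm : (s + Fintype.card κ * 2 ^ s) * 6 ≤ m)
    (blk : V → ι) (kind : V → Fin 3) (τ : V → κ)
    (D : V → V → Prop) (β : κ → κ → Prop) (hsymm : ∀ a b, D a b → D b a)
    (hD : ∀ a b, D a b → a ∉ F ∧ blk a = blk b ∧ kind a ≠ kind b)
    (h2 : ∀ x x' y y', blk x = blk x' → blk x = blk y → blk x = blk y' → kind x = kind x' →
      kind y = kind y' → kind x ≠ kind y → D x y → D x' y' → D x y' ∨ D x' y)
    (h3 : ∀ x w y, blk x = blk w → blk x = blk y → kind x = 0 → kind w = 1 → kind y = 2 →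
      (D x w → D w y → D x y) ∧ (¬ D x w → ¬ D w y → ¬ D x y))
    (hG : ∀ a ∉ F, ∀ b ∉ F, a ≠ b → (G.Adj a b ↔ (β (τ a) (τ b) ↔ ¬ D a b))) :
    BranchTree (CutBound G (m + 2 ^ m)) univ := by
  classical
  have : Fintype F := Fintype.ofFinite F
  have hFs : Fintype.card F ≤ s := by rwa [← Nat.card_eq_fintype_card, Nat.card_coe_set_eq]
  have hcard : Fintype.card ((F ⊕ κ × Set F) × Fin 3 × Bool) ≤ m := by
    simp only [Fintype.card_prod, Fintype.card_sum, Fintype.card_set, Fintype.card_fin,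
      Fintype.card_bool]
    refine le_trans (Nat.mul_le_mul_right _ (add_le_add hFs (Nat.mul_le_mul_left _
      (Nat.pow_le_pow_right (by norm_num) hFs)))) hm
  -- Each exceptional vertex is its own type; every other vertex also records its neighbours in `F`.
  refine branchTree_of_blocks G hcard blk kind
    (fun v => if h : v ∈ F then .inl ⟨v, h⟩ else .inr (τ v, {w | G.Adj w v})) D
    (fun i j => match i, j with
      | .inl a, .inl b => G.Adj a b
      | .inl a, .inr (_, T) => a ∈ T
      | .inr (_, T), .inl a => a ∈ T
      | .inr (i, _), .inr (j, _) => β i j) hsymm (fun a b h => (hD a b h).2) h2 h3 ?_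
  intro a b hab
  by_cases ha : a ∈ F
  · have : ¬ D a b := fun h => (hD a b h).1 ha
    by_cases hb : b ∈ F <;> simp [ha, hb, this]
  · by_cases hb : b ∈ F
    · have : ¬ D a b := fun h => (hD b a (hsymm _ _ h)).1 hb
      simp [ha, hb, this, G.adj_comm]
    · simp [ha, hb, hG a ha b hb hab]

end Layout

/-! ### Induced cycles of length at least seven in pentagon-free graphs. -/

section Hole

open Set

variable {V : Type*}

/-- No three pairwise adjacent vertices. -/
def TriangleFree (G : SimpleGraph V) : Prop :=
  ∀ a b c, G.Adj a b → G.Adj b c → ¬ G.Adj a c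

/-- In a triangle-free graph: no induced `S_{1,2,2}` with centre `c`, pendant vertex `x` and
arms `y, y'` and `z, z'`. -/
def ForkFree (G : SimpleGraph V) : Prop :=
  ∀ c x y y' z z', G.Adj c x → G.Adj c y → G.Adj c z → G.Adj y y' → G.Adj z z' →
    ¬ G.Adj x y' → ¬ G.Adj x z' → ¬ G.Adj y z' → ¬ G.Adj z y' → G.Adj y' z'

/-- No closed walk of length five; in a triangle-free graph, no induced five-cycle. -/
def PentagonFree (G : SimpleGraph V) : Prop :=
  ∀ a b c d e, G.Adj a b → G.Adj b c → G.Adj c d → G.Adj d e → ¬ G.Adj e a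

/-- An induced cycle of length `n`. -/
def IsHole (G : SimpleGraph V) {n : ℕ} (p : ZMod n → V) : Prop :=
  Function.Injective p ∧ ∀ i j, G.Adj (p i) (p j) ↔ j = i + 1 ∨ i = j + 1

variable {G : SimpleGraph V} {n : ℕ} {p : ZMod n → V}

theorem ZMod.natCast_ne_zero_of_lt {m : ℕ} (h0 : 0 < m) (hm : m < n) : (m : ZMod n) ≠ 0 := by
  rw [Ne, ZMod.natCast_eq_zero_iff]
  exact Nat.not_dvd_of_pos_of_lt h0 hm

theorem IsHole.adj_succ (hp : IsHole G p) (k : ZMod n) (a : ℕ) :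
    G.Adj (p (k + a)) (p (k + (a + 1 : ℕ))) := by
  rw [hp.2]
  left
  push_cast
  ring

theorem IsHole.not_adj (hp : IsHole G p) (k : ZMod n) (a b : ℕ) (h : a + 2 ≤ b)
    (h' : b + 2 ≤ n + a) : ¬ G.Adj (p (k + a)) (p (k + b)) := by
  obtain ⟨d, rfl⟩ := Nat.exists_eq_add_of_le h
  rw [hp.2]
  rintro (h | h)
  · refine ZMod.natCast_ne_zero_of_lt (n := n) (m := d + 1) (by omega) (by omega) ?_
    push_cast at h ⊢
    linear_combination h
  · refine ZMod.natCast_ne_zero_of_lt (n := n) (m := d + 3) (by omega) (by omega) ?_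
    push_cast at h ⊢
    linear_combination -h

/-- If `v` sees neither vertex at distance two from `p i`, then `v` and the five cycle vertices
around `p i` form a fork. So `v` sees two cycle vertices at distance two, and `three` and `two`
exclude any further neighbour. -/
theorem IsHole.neighbors (hE : ForkFree G) (h5 : PentagonFree G) (hn : 7 ≤ n) (hp : IsHole G p)
    {v : V} {i : ZMod n} (hv : G.Adj v (p i)) :
    ∃ t, ∀ j, G.Adj v (p j) ↔ j = t - 1 ∨ j = t + 1 := by
  -- The fork centred at `v` forces an edge between positions `0` and `6`, which closes a pentagon.
  have three : ∀ k : ZMod n, G.Adj v (p (k + (1 : ℕ))) → G.Adj v (p (k + (3 : ℕ))) →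
      ¬ G.Adj v (p (k + (5 : ℕ))) := by
    intro k h1 h3 h5'
    have h06 := hE v _ _ (p (k + (0 : ℕ))) _ (p (k + (6 : ℕ))) h3 h1 h5' (hp.adj_succ k 0).symm
      (hp.adj_succ k 5) (fun h => hp.not_adj k 0 3 (by omega) (by omega) h.symm)
      (hp.not_adj k 3 6 (by omega) (by omega)) (hp.not_adj k 1 6 (by omega) (by omega))
      (fun h => hp.not_adj k 0 5 (by omega) (by omega) h.symm)
    exact h5 v _ _ _ _ h1 (hp.adj_succ k 0).symm h06 (hp.adj_succ k 5).symm h5'.symm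
  have two : ∀ k : ZMod n, G.Adj v (p (k + (1 : ℕ))) → G.Adj v (p (k + (3 : ℕ))) →
      ∀ j, G.Adj v (p j) → j = k + (1 : ℕ) ∨ j = k + (3 : ℕ) := by
    intro k h1 h3 j hj
    by_contra hne
    push Not at hne
    refine hp.not_adj k 0 4 (by omega) (by omega) (hE v (p j) _ (p (k + (0 : ℕ))) _
      (p (k + (4 : ℕ))) hj h1 h3 (hp.adj_succ k 0).symm (hp.adj_succ k 3) ?_ ?_
      (hp.not_adj k 1 4 (by omega) (by omega))
      (fun h => hp.not_adj k 0 3 (by omega) (by omega) h.symm))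
    · rw [hp.2]
      rintro (h | h)
      · refine three (k - 2) ?_ ?_ ?_
        · convert hj using 2
          push_cast at h ⊢
          linear_combination h
        · convert h1 using 2
          push_cast
          ring
        · convert h3 using 2
          push_cast
          ring
      · refine hne.1 ?_
        push_cast at h ⊢
        linear_combination h
    · rw [hp.2]
      rintro (h | h)
      · refine hne.2 ?_
        push_cast at h ⊢
        linear_combination -h
      · refine three k h1 h3 ?_
        convert hj using 2
        push_cast at h ⊢
        linear_combination -h
  have exact_of : ∀ k : ZMod n, G.Adj v (p (k + (1 : ℕ))) → G.Adj v (p (k + (3 : ℕ))) →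
      ∃ t, ∀ j, G.Adj v (p j) ↔ j = t - 1 ∨ j = t + 1 := by
    intro k h1 h3
    refine ⟨k + 2, fun j => ⟨fun h => ?_, ?_⟩⟩
    · refine (two k h1 h3 j h).imp (fun h => ?_) fun h => ?_
      · rw [h]
        push_cast
        ring
      · rw [h]
        push_cast
        ring
    · rintro (rfl | rfl)
      · convert h1 using 2
        push_cast
        ring
      · convert h3 using 2
        push_cast
        ring
  by_cases h0 : G.Adj v (p (i - 2))
  · refine exact_of (i - 3) ?_ ?_
    · convert h0 using 2
      push_cast
      ring
    · convert hv using 2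
      push_cast
      ring
  by_cases h4 : G.Adj v (p (i + 2))
  · refine exact_of (i - 1) ?_ ?_
    · convert hv using 2
      push_cast
      ring
    · convert h4 using 2
      push_cast
      ring
  refine (hp.not_adj (i - 2) 0 4 (by omega) (by omega) (hE (p (i - 2 + (2 : ℕ))) v
    (p (i - 2 + (1 : ℕ))) (p (i - 2 + (0 : ℕ))) (p (i - 2 + (3 : ℕ))) (p (i - 2 + (4 : ℕ))) ?_
    (hp.adj_succ _ 1).symm (hp.adj_succ _ 2) (hp.adj_succ _ 0).symm (hp.adj_succ _ 3) ?_ ?_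
    (hp.not_adj _ 1 4 (by omega) (by omega))
    (fun h => hp.not_adj _ 0 3 (by omega) (by omega) h.symm))).elim
  · convert hv.symm using 2
    push_cast
    ring
  · simpa using h0
  · convert h4 using 3
    push_cast
    ring

theorem IsHole.update (hn : 7 ≤ n) (hp : IsHole G p) {q : V} {t : ZMod n}
    (hq : ∀ j, G.Adj q (p j) ↔ j = t - 1 ∨ j = t + 1) :
    IsHole G (Function.update p t q) := by
  have h4 : (4 : ZMod n) ≠ 0 := by
    exact_mod_cast ZMod.natCast_ne_zero_of_lt (n := n) (m := 4) (by omega) (by omega)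
  have h1 : (1 : ZMod n) ≠ 0 := by
    exact_mod_cast ZMod.natCast_ne_zero_of_lt (n := n) (m := 1) (by omega) (by omega)
  have hne : ∀ j, j ≠ t → p j ≠ q := by
    rintro j hj rfl
    have ha := (hp.2 j (t - 1)).1 ((hq _).2 (.inl rfl))
    have hb := (hp.2 j (t + 1)).1 ((hq _).2 (.inr rfl))
    rcases hb with hb | hb
    · exact hj (add_right_cancel hb).symm
    · rcases ha with ha | ha
      · exact h4 (by linear_combination -ha - hb)
      · exact hj (by linear_combination ha)
  refine ⟨fun i j hij => ?_, fun i j => ?_⟩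
  · by_cases hi : i = t <;> by_cases hj : j = t
    · rw [hi, hj]
    · rw [hi, Function.update_self, Function.update_of_ne hj] at hij
      exact (hne j hj hij.symm).elim
    · rw [hj, Function.update_self, Function.update_of_ne hi] at hij
      exact (hne i hi hij).elim
    · rw [Function.update_of_ne hi, Function.update_of_ne hj] at hij
      exact hp.1 hij
  · by_cases hi : i = t <;> by_cases hj : j = t
    · rw [hi, hj]
      simp [h1]
    · rw [hi, Function.update_self, Function.update_of_ne hj, hq, or_comm]
      exact or_congr_right (by rw [sub_eq_iff_eq_add.symm, eq_comm])
    · rw [hj, Function.update_self, Function.update_of_ne hi, G.adj_comm, hq]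
      exact or_congr_left (by rw [eq_sub_iff_add_eq, eq_comm])
    · rw [Function.update_of_ne hi, Function.update_of_ne hj, hp.2]

/-- On the cycle with `q` substituted, `s` sees exactly `q` and a vertex two steps from `t`. On the
original cycle the second neighbour of `s` is then at `t` or four steps from `t`, and the
substituted cycle rules out the latter. -/
theorem IsHole.adj_of_adj_twin (hE : ForkFree G) (h5 : PentagonFree G) (hn : 7 ≤ n)
    (hp : IsHole G p) {q : V} {t : ZMod n} (hq : ∀ j, G.Adj q (p j) ↔ j = t - 1 ∨ j = t + 1)
    {s : V} (hs : G.Adj s q) : G.Adj s (p t) := by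
  have h2 : (2 : ZMod n) ≠ 0 := by
    exact_mod_cast ZMod.natCast_ne_zero_of_lt (n := n) (m := 2) (by omega) (by omega)
  have h4 : (4 : ZMod n) ≠ 0 := by
    exact_mod_cast ZMod.natCast_ne_zero_of_lt (n := n) (m := 4) (by omega) (by omega)
  have hu := hp.update hn hq
  obtain ⟨t', ht'⟩ := hu.neighbors hE h5 hn (v := s) (i := t) (by rwa [Function.update_self])
  have hold : ∀ j, j ≠ t → (G.Adj s (p j) ↔ j = t' - 1 ∨ j = t' + 1) := fun j hj => by
    rw [← ht', Function.update_of_ne hj]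
  have htt := (ht' t).1 (by rwa [Function.update_self])
  rcases htt with htt | htt
  · have hs2 : G.Adj s (p (t + 2)) := (hold _ (by simpa using h2)).2
      (.inr (by linear_combination htt))
    obtain ⟨k, hk⟩ := hp.neighbors hE h5 hn hs2
    rcases (hk _).1 hs2 with h | h
    · have hs4 : G.Adj s (p (t + 4)) := (hk _).2 (.inr (by linear_combination h))
      rcases (hold _ (by simpa using h4)).1 hs4 with h' | h'
      · exact (h4 (by linear_combination h' - htt)).elim
      · exact (h2 (by linear_combination h' - htt)).elim
    · exact (hk _).2 (.inl (by linear_combination h))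
  · have hs2 : G.Adj s (p (t - 2)) := (hold _ (by simpa using h2)).2
      (.inl (by linear_combination htt))
    obtain ⟨k, hk⟩ := hp.neighbors hE h5 hn hs2
    rcases (hk _).1 hs2 with h | h
    · exact (hk _).2 (.inr (by linear_combination h))
    · have hs4 : G.Adj s (p (t - 4)) := (hk _).2 (.inl (by linear_combination h))
      rcases (hold _ (by simpa using h4)).1 hs4 with h' | h'
      · exact (h2 (by linear_combination htt - h')).elim
      · exact (h4 (by linear_combination htt - h')).elim

/-- Neighbours of the cycle are twins of its vertices, hence equal to them, so the cycle is closed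
under adjacency. -/
theorem IsHole.surjective (hE : ForkFree G) (h5 : PentagonFree G) (hs : SplitFree G)
    (hc : 4 ≤ Nat.card V) (hn : 7 ≤ n) (hp : IsHole G p) : Function.Surjective p := by
  rw [← range_eq_univ]
  refine hs.eq_univ_of_closed hc ⟨p 0, mem_range_self 0⟩ ?_
  rintro _ ⟨i, rfl⟩ q hq
  obtain ⟨t, ht⟩ := hp.neighbors hE h5 hn hq.symm
  refine ⟨t, hs.eq_of_twins hc fun s => ⟨fun h => ?_, fun h => ?_⟩⟩
  · have hu := hp.update hn ht
    have := hu.adj_of_adj_twin hE h5 hn (q := p t) (t := t) (fun j => ?_) h.symm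
    · rw [Function.update_self] at this
      exact this.symm
    · have h1 : (1 : ZMod n) ≠ 0 := by
        exact_mod_cast ZMod.natCast_ne_zero_of_lt (n := n) (m := 1) (by omega) (by omega)
      by_cases hj : j = t
      · subst hj
        simp [h1, G.adj_comm (p j) q, ht]
      · rw [Function.update_of_ne hj, hp.2, or_comm, eq_sub_iff_add_eq, eq_comm (a := t)]
  · exact (hp.adj_of_adj_twin hE h5 hn ht h.symm).symm

theorem IsHole.branchTree [Finite V] [Nonempty V] (hn : 2 ≤ n) (hp : IsHole G p)
    (hsurj : Function.Surjective p) : BranchTree (CutBound G (3 + 2 ^ 3)) univ := by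
  have : NeZero n := ⟨by omega⟩
  have : Fact (1 < n) := ⟨by omega⟩
  let e := Equiv.ofBijective p ⟨hp.1, hsurj⟩
  let f : V → ℕ := fun v => (e.symm v).val
  have hf : Function.Injective f := (ZMod.val_injective n).comp e.symm.injective
  have hadj : ∀ x y, G.Adj x y ↔ e.symm y = e.symm x + 1 ∨ e.symm x = e.symm y + 1 := by
    intro x y
    rw [← hp.2]
    change _ ↔ G.Adj (e (e.symm x)) (e (e.symm y))
    rw [e.apply_symm_apply, e.apply_symm_apply]
  have hsucc : ∀ i : ZMod n, (i + 1).val = i.val + 1 ∨ (i + 1).val = 0 := by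
    intro i
    by_cases h : i.val + 1 < n
    · left
      rw [ZMod.val_add_of_lt] <;> rw [ZMod.val_one]
      exact h
    · right
      rw [ZMod.val_add, ZMod.val_one, show i.val + 1 = n from by have := i.val_lt; omega,
        Nat.mod_self]
  refine branchTree_of_layout G (κ := Fin 3) (by simp) f hf fun m => ?_
  -- Only the first and the last vertex of a prefix can have later neighbours.
  refine ⟨fun v => if f v = 0 then 0 else if f v + 1 = m then 1 else 2, ?_⟩
  intro x x' hx hx' hxx y hy hxy
  have no : f x = 0 ∨ f x + 1 = m := by
    by_contra h
    push Not at h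
    rcases (hadj x y).1 hxy with h1 | h1
    · have h2 := hsucc (e.symm x)
      rw [← h1] at h2
      change f y = f x + 1 ∨ f y = 0 at h2
      omega
    · have h2 := hsucc (e.symm y)
      rw [← h1] at h2
      change f x = f y + 1 ∨ f x = 0 at h2
      omega
  have : f x = f x' := by
    by_cases h0 : f x = 0 <;> by_cases h0' : f x' = 0 <;> by_cases h1 : f x + 1 = m <;>
      by_cases h1' : f x' + 1 = m <;> simp [h0, h0', h1, h1'] at hxx <;> omega
  rwa [← hf this]

end Hole

/-! ### Vertices attached to a five-cycle. -/

section Pentagon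

open Set

variable {V : Type*}

/-- The vertices adjacent to both cycle neighbours of the `j`-th vertex of a five-cycle. -/
def IsCopy (G : SimpleGraph V) (p : ZMod 5 → V) (j : ZMod 5) (x : V) : Prop :=
  G.Adj x (p (j + 1)) ∧ G.Adj x (p (j - 1))

/-- The vertices whose only neighbour on the five-cycle is the `j`-th vertex. -/
def IsPendant (G : SimpleGraph V) (p : ZMod 5 → V) (j : ZMod 5) (x : V) : Prop :=
  G.Adj x (p j) ∧ ∀ k, k ≠ j → ¬ G.Adj x (p k)

variable {G : SimpleGraph V} {p : ZMod 5 → V}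

/-- Rotations and reflections allow the fork arguments below to be carried out at fixed indices. -/
theorem isCopy_rotate {i j : ZMod 5} {x : V} :
    IsCopy G (fun k => p (i + k)) j x ↔ IsCopy G p (i + j) x := by
  simp only [IsCopy, add_assoc, add_sub_assoc]

theorem isCopy_reflect {i j : ZMod 5} {x : V} :
    IsCopy G (fun k => p (i - k)) j x ↔ IsCopy G p (i - j) x := by
  rw [IsCopy, IsCopy, and_comm, sub_add_eq_sub_sub, sub_sub_eq_add_sub, add_sub_right_comm]

theorem isPendant_rotate {i j : ZMod 5} {x : V} :
    IsPendant G (fun k => p (i + k)) j x ↔ IsPendant G p (i + j) x := by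
  refine and_congr_right fun _ => ⟨fun h k hk => ?_, fun h k hk => ?_⟩
  · have := h (k - i) (fun e => hk (by rw [← e]; ring))
    simpa only [add_sub_cancel] using this
  · exact h _ fun e => hk (add_left_cancel e)

theorem isPendant_reflect {i j : ZMod 5} {x : V} :
    IsPendant G (fun k => p (i - k)) j x ↔ IsPendant G p (i - j) x := by
  refine and_congr_right fun _ => ⟨fun h k hk => ?_, fun h k hk => ?_⟩
  · have := h (i - k) (fun e => hk (by rw [← e]; ring))
    simpa only [sub_sub_cancel] using this
  · exact h _ fun e => hk (by linear_combination -e)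

theorem pentagon_rotate (hp : ∀ i, G.Adj (p i) (p (i + 1))) (i : ZMod 5) :
    ∀ k, G.Adj (p (i + k)) (p (i + (k + 1))) := fun k => by
  rw [← add_assoc]
  exact hp _

theorem pentagon_reflect (hp : ∀ i, G.Adj (p i) (p (i + 1))) (i : ZMod 5) :
    ∀ k, G.Adj (p (i - k)) (p (i - (k + 1))) := fun k => by
  have := hp (i - (k + 1))
  rw [show i - (k + 1) + 1 = i - k by ring] at this
  exact this.symm

theorem IsCopy.not_adj (hT : TriangleFree G) (hp : ∀ i, G.Adj (p i) (p (i + 1))) {j : ZMod 5}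
    {x : V} (hx : IsCopy G p j x) (k : ZMod 5) (h1 : k ≠ j + 1) (h2 : k ≠ j - 1) :
    ¬ G.Adj x (p k) := by
  have key : ∀ j k : ZMod 5, k ≠ j + 1 → k ≠ j - 1 → k = j + 1 + 1 ∨ j + 1 = k + 1 ∨
    k = j - 1 + 1 ∨ j - 1 = k + 1 := by decide
  intro h
  rcases key j k h1 h2 with e | e | e | e
  · subst e
    exact hT _ _ _ hx.1 (hp _) h
  · have := hp k
    rw [← e] at this
    exact hT _ _ _ h this hx.1
  · subst e
    exact hT _ _ _ hx.2 (hp _) h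
  · have := hp k
    rw [← e] at this
    exact hT _ _ _ h this hx.2

theorem isCopy_self (hp : ∀ i, G.Adj (p i) (p (i + 1))) (j : ZMod 5) : IsCopy G p j (p j) := by
  refine ⟨hp j, ?_⟩
  have := hp (j - 1)
  rw [sub_add_cancel] at this
  exact this.symm

theorem pentagon_chord (hT : TriangleFree G) (hp : ∀ i, G.Adj (p i) (p (i + 1))) {i j : ZMod 5}
    (h1 : j ≠ i + 1) (h2 : j ≠ i - 1) : ¬ G.Adj (p i) (p j) :=
  (isCopy_self hp i).not_adj hT hp j h1 h2

theorem isCopy_or_isPendant (hT : TriangleFree G) (hp : ∀ i, G.Adj (p i) (p (i + 1))) {x : V}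
    {i : ZMod 5} (hx : G.Adj x (p i)) :
    IsPendant G p i x ∨ IsCopy G p (i + 1) x ∨ IsCopy G p (i - 1) x := by
  have key : ∀ i k : ZMod 5, k ≠ i → k = i + 1 ∨ i = k + 1 ∨ k = i + 1 + 1 ∨ k = i - 1 - 1 := by
    decide
  by_cases h : ∃ k, k ≠ i ∧ G.Adj x (p k)
  · right
    obtain ⟨k, hk, hxk⟩ := h
    rcases key i k hk with e | e | e | e
    · subst e
      exact (hT _ _ _ hx (hp _) hxk).elim
    · subst e
      exact (hT _ _ _ hxk (hp _) hx).elim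
    · subst e
      exact .inl ⟨hxk, by rwa [add_sub_cancel_right]⟩
    · subst e
      exact .inr ⟨by rwa [sub_add_cancel], hxk⟩
  · push Not at h
    exact .inl ⟨hx, h⟩

/-- Copies of cycle vertices with a common cycle neighbour are not adjacent. -/
theorem IsCopy.not_adj_copy (hT : TriangleFree G) {i j : ZMod 5} {x y : V} (hx : IsCopy G p i x)
    (hy : IsCopy G p j y) (h1 : j ≠ i + 1) (h2 : i ≠ j + 1) : ¬ G.Adj x y := by
  have key : ∀ i j : ZMod 5, j ≠ i + 1 → i ≠ j + 1 → i = j ∨ i + 1 = j - 1 ∨ i - 1 = j + 1 := by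
    decide
  intro h
  rcases key i j h1 h2 with e | e | e
  · subst e
    exact hT _ _ _ h hy.1 hx.1
  · refine hT _ _ _ h hy.2 ?_
    rw [← e]
    exact hx.1
  · refine hT _ _ _ h hy.1 ?_
    rw [← e]
    exact hx.2

theorem IsCopy.not_adj_pendant (hT : TriangleFree G) {i j : ZMod 5} {x w : V}
    (hx : IsCopy G p i x) (hw : IsPendant G p j w) (h : i = j + 1 ∨ i = j - 1) :
    ¬ G.Adj x w := by
  intro hxw
  rcases h with e | e
  · subst e
    exact hT _ _ _ hxw hw.1 (by simpa using hx.2)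
  · subst e
    exact hT _ _ _ hxw hw.1 (by simpa using hx.1)

/-- Otherwise `q`, `t` form one arm of a fork whose remaining vertices lie on the cycle. By
connectivity, every vertex of a split-free graph is then attached to the cycle. -/
theorem not_adj_of_far {t q : V} (hT : TriangleFree G) (hE : ForkFree G)
    (hp : ∀ i, G.Adj (p i) (p (i + 1))) (ht : ∀ k, ¬ G.Adj t (p k)) {i : ZMod 5}
    (hq : G.Adj q (p i)) : ¬ G.Adj q t := by
  intro hqt
  have pend : ∀ p : ZMod 5 → V, (∀ i, G.Adj (p i) (p (i + 1))) → (∀ k, ¬ G.Adj t (p k)) →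
      IsPendant G p 0 q → False := by
    intro p hp ht hq
    exact ht 2 (hE (p 0) (p 4) q t (p 1) (p 2) (hp 4).symm hq.1.symm (hp 0) hqt (hp 1)
      (fun h => ht _ h.symm) (pentagon_chord hT hp (by decide) (by decide))
      (hq.2 2 (by decide)) (fun h => ht _ h.symm))
  have copy : ∀ p : ZMod 5 → V, (∀ i, G.Adj (p i) (p (i + 1))) → (∀ k, ¬ G.Adj t (p k)) →
      IsCopy G p 0 q → False := by
    intro p hp ht hq
    exact ht 3 (hE (p 1) (p 0) q t (p 2) (p 3) (hp 0).symm hq.1.symm (hp 1) hqt (hp 2)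
      (fun h => ht _ h.symm) (pentagon_chord hT hp (by decide) (by decide))
      (hq.not_adj hT hp 3 (by decide) (by decide)) (fun h => ht _ h.symm))
  rcases isCopy_or_isPendant hT hp hq with h | h | h
  · exact pend _ (pentagon_rotate hp i) (fun k => ht _) (isPendant_rotate.2 (by rwa [add_zero]))
  · exact copy _ (pentagon_rotate hp (i + 1)) (fun k => ht _)
      (isCopy_rotate.2 (by rwa [add_zero]))
  · exact copy _ (pentagon_rotate hp (i - 1)) (fun k => ht _)
      (isCopy_rotate.2 (by rwa [add_zero]))

/-- Both cases use one fork: centre `p 0`, pendant vertex `q`, arms `p 1, w` and `p 4, p 3`. It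
would make `w` adjacent to `p 3`. -/
theorem adj_pendant_one (hT : TriangleFree G) (hE : ForkFree G)
    (hp : ∀ i, G.Adj (p i) (p (i + 1))) {w q : V}
    (hw : IsPendant G p 1 w)
    (hq : IsCopy G p 1 q ∨ IsPendant G p 0 q) : G.Adj q w := by
  by_contra h
  have hq0 : G.Adj q (p 0) := hq.elim (fun h => h.2) fun h => h.1
  have hq3 : ¬ G.Adj q (p 3) := hq.elim (fun h => h.not_adj hT hp 3 (by decide) (by decide))
    fun h => h.2 3 (by decide)
  exact hw.2 3 (by decide) (hE (p 0) q (p 1) w (p 4) (p 3) hq0.symm (hp 0) (hp 4).symm hw.1.symm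
    (hp 3).symm h hq3 (pentagon_chord hT hp (by decide) (by decide))
    fun h => hw.2 4 (by decide) h.symm)

theorem not_adj_pendant_two (hT : TriangleFree G) (hE : ForkFree G)
    (hp : ∀ i, G.Adj (p i) (p (i + 1))) {w w' : V}
    (hw : IsPendant G p 0 w) (hw' : IsPendant G p 2 w') :
    ¬ G.Adj w w' := by
  intro h
  exact hw'.2 3 (by decide) (hE (p 0) (p 1) w w' (p 4) (p 3) (hp 0) hw.1.symm (hp 4).symm h
    (hp 3).symm (fun h => hw'.2 1 (by decide) h.symm)
    (pentagon_chord hT hp (by decide) (by decide)) (hw.2 3 (by decide))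
    fun h => hw'.2 4 (by decide) h.symm)

theorem adj_or_adj_of_copies (hT : TriangleFree G) (hE : ForkFree G)
    (hp : ∀ i, G.Adj (p i) (p (i + 1))) {y z t : V}
    (hy : IsCopy G p 1 y) (hz : IsCopy G p 2 z)
    (ht : IsCopy G p 3 t) : G.Adj y z ∨ G.Adj z t := by
  by_contra! h
  exact h.2 (hE (p 0) y (p 1) z (p 4) t hy.2.symm (hp 0) (hp 4).symm hz.2.symm ht.1.symm h.1
    (hy.not_adj_copy hT ht (by decide) (by decide))
    (fun h => ht.not_adj hT hp 1 (by decide) (by decide) h.symm)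
    fun h => hz.not_adj hT hp 4 (by decide) (by decide) h.symm)

/-- In the fork centred at `p 0` with arms `w, z` and `y, p 2`, the forced edge would join `z` to
the vertex it copies. -/
theorem adj_copy_of_adj_pendant (hT : TriangleFree G) (hE : ForkFree G)
    (hp : ∀ i, G.Adj (p i) (p (i + 1))) {y z w : V}
    (hy : IsCopy G p 1 y) (hz : IsCopy G p 2 z)
    (hw : IsPendant G p 0 w) (hzw : G.Adj z w) : G.Adj y z := by
  by_contra h
  exact hz.not_adj hT hp 2 (by decide) (by decide) (hE (p 0) (p 4) w z y (p 2) (hp 4).symm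
    hw.1.symm hy.2.symm hzw.symm hy.1
    (fun h => hz.not_adj hT hp 4 (by decide) (by decide) h.symm)
    (pentagon_chord hT hp (by decide) (by decide)) (hw.2 2 (by decide)) h)

theorem adj_or_adj_pendant (hT : TriangleFree G) (hE : ForkFree G)
    (hp : ∀ i, G.Adj (p i) (p (i + 1))) {z t w : V}
    (hz : IsCopy G p 2 z) (ht : IsCopy G p 3 t)
    (hw : IsPendant G p 0 w) (hzt : ¬ G.Adj z t) : G.Adj z w ∨ G.Adj t w := by
  by_contra! h
  exact h.1 (hE (p 4) t (p 3) z (p 0) w ht.1.symm (hp 3).symm (hp 4) hz.1.symm hw.1.symm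
    (fun h => hzt h.symm) h.2 (fun h => hw.2 3 (by decide) h.symm)
    fun h => hz.not_adj hT hp 0 (by decide) (by decide) h.symm)

/-- Two independent edges would be the outer edges of a fork centred at `p 1`, so the bipartite
graph is a chain graph. -/
theorem copies_chain (hT : TriangleFree G) (hE : ForkFree G)
    (hp : ∀ i, G.Adj (p i) (p (i + 1))) {z z' t t' : V}
    (hz : IsCopy G p 2 z) (hz' : IsCopy G p 2 z')
    (ht : IsCopy G p 3 t) (ht' : IsCopy G p 3 t') (h : G.Adj z t) (h' : G.Adj z' t') :
    G.Adj z t' ∨ G.Adj z' t := by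
  by_contra! hn
  exact ht.not_adj_copy hT ht' (by decide) (by decide) (hE (p 1) (p 0) z t z' t' (hp 0).symm
    hz.2.symm hz'.2.symm h h' (fun h => ht.not_adj hT hp 0 (by decide) (by decide) h.symm)
    (fun h => ht'.not_adj hT hp 0 (by decide) (by decide) h.symm) hn.1 hn.2)

theorem pendant_chain (hT : TriangleFree G) (hE : ForkFree G)
    (hp : ∀ i, G.Adj (p i) (p (i + 1))) {z z' w w' : V}
    (hz : IsCopy G p 2 z) (hz' : IsCopy G p 2 z')
    (hw : IsPendant G p 0 w) (hw' : IsPendant G p 0 w') (h : G.Adj z w) (h' : G.Adj z' w') :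
    G.Adj z w' ∨ G.Adj z' w := by
  by_contra! hn
  exact hz.not_adj_copy hT hz' (by decide) (by decide) (hE (p 0) (p 4) w z w' z' (hp 4).symm
    hw.1.symm hw'.1.symm h.symm h'.symm
    (fun h => hz.not_adj hT hp 4 (by decide) (by decide) h.symm)
    (fun h => hz'.not_adj hT hp 4 (by decide) (by decide) h.symm) (fun h => hn.2 h.symm)
    fun h => hn.1 h.symm)

end Pentagon

/-! ### Block structure around a five-cycle. -/

section PentagonStructure

open Set

variable {V : Type*} {G : SimpleGraph V} {p : ZMod 5 → V}

/-- A copy `z` of the `j`-th cycle vertex which deviates from it on the positive side. -/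
def DeviatesUp (G : SimpleGraph V) (p : ZMod 5 → V) (j : ZMod 5) (z : V) : Prop :=
  (∃ t, IsCopy G p (j + 1) t ∧ ¬ G.Adj z t) ∨ ∃ w, IsPendant G p (j - 2) w ∧ G.Adj z w

variable (hT : TriangleFree G) (hE : ForkFree G) (hp : ∀ i, G.Adj (p i) (p (i + 1)))

include hT hE hp

theorem adj_pendants_succ {j : ZMod 5} {w w' : V} (hw : IsPendant G p j w)
    (hw' : IsPendant G p (j + 1) w') : G.Adj w w' :=
  adj_pendant_one hT hE (pentagon_rotate hp j) (isPendant_rotate.2 hw')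
    (.inr (isPendant_rotate.2 (by rwa [add_zero])))

theorem adj_copy_pendant {j : ZMod 5} {z w : V} (hz : IsCopy G p j z)
    (hw : IsPendant G p j w) : G.Adj z w := by
  refine adj_pendant_one hT hE (pentagon_rotate hp (j - 1)) (isPendant_rotate.2 ?_)
    (.inl (isCopy_rotate.2 ?_)) <;> rwa [sub_add_cancel]

theorem adj_pendants_iff {i j : ZMod 5} {w w' : V} (hw : IsPendant G p i w)
    (hw' : IsPendant G p j w') : G.Adj w w' ↔ j = i + 1 ∨ i = j + 1 := by
  have key : ∀ i j : ZMod 5, i = j ∨ j = i + 1 ∨ i = j + 1 ∨ j = i + 2 ∨ i = j + 2 := by decide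
  have two : ∀ i : ZMod 5, ¬ (i + 2 = i + 1 ∨ i = i + 2 + 1) := by decide
  rcases key i j with e | e | e | e | e
  · subst e
    refine iff_of_false (fun h => hT _ _ _ h hw'.1 hw.1) ?_
    rw [or_self]
    exact fun h => absurd (left_eq_add.1 h) (by decide)
  · subst e
    simp [adj_pendants_succ hT hE hp hw hw']
  · subst e
    simp [(adj_pendants_succ hT hE hp hw' hw).symm]
  · subst e
    refine iff_of_false ?_ (two i)
    exact not_adj_pendant_two hT hE (pentagon_rotate hp i)
      (isPendant_rotate.2 (by rwa [add_zero])) (isPendant_rotate.2 hw')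
  · subst e
    refine iff_of_false ?_ (fun h => two j h.symm)
    exact fun h => not_adj_pendant_two hT hE (pentagon_rotate hp j)
      (isPendant_rotate.2 (by rwa [add_zero])) (isPendant_rotate.2 hw) h.symm

/-- A copy deviates on at most one side. This assigns every copy to a single block, and makes the
five blocks independent of one another. -/
theorem not_adj_of_deviatesUp {j : ZMod 5} {z : V} (hz : IsCopy G p j z)
    (hd : DeviatesUp G p j z) :
    (∀ y, IsCopy G p (j - 1) y → G.Adj y z) ∧ ∀ w, IsPendant G p (j + 2) w → ¬ G.Adj z w := by
  have hrot := pentagon_rotate hp (j - 2)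
  have href := pentagon_reflect hp (j + 2)
  have hz' : IsCopy G (fun k => p (j - 2 + k)) 2 z :=
    isCopy_rotate.2 (by rwa [sub_add_cancel])
  have hz'' : IsCopy G (fun k => p (j + 2 - k)) 2 z :=
    isCopy_reflect.2 (by rwa [add_sub_cancel_right])
  have cy : ∀ y, IsCopy G p (j - 1) y → IsCopy G (fun k => p (j - 2 + k)) 1 y := fun y hy =>
    isCopy_rotate.2 (by rwa [show j - 2 + 1 = j - 1 by ring])
  rcases hd with ⟨t, ht, hzt⟩ | ⟨w, hw, hzw⟩
  · refine ⟨fun y hy => ?_, fun w' hw' h => ?_⟩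
    · refine (adj_or_adj_of_copies hT hE hrot (cy y hy) hz' (isCopy_rotate.2 ?_)).resolve_right hzt
      rwa [show j - 2 + 3 = j + 1 by ring]
    · refine hzt (adj_copy_of_adj_pendant hT hE href (isCopy_reflect.2 ?_) hz''
        (isPendant_reflect.2 ?_) h).symm
      · rwa [show j + 2 - 1 = j + 1 by ring]
      · rwa [sub_zero]
  · have hw0 : IsPendant G (fun k => p (j - 2 + k)) 0 w := isPendant_rotate.2 (by rwa [add_zero])
    refine ⟨fun y hy => adj_copy_of_adj_pendant hT hE hrot (cy y hy) hz' hw0 hzw,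
      fun w' hw' h => ?_⟩
    have hww : G.Adj w' w := (adj_pendants_iff hT hE hp hw' hw).2
      (.inl (by
        have : ∀ j : ZMod 5, j - 2 = j + 2 + 1 := by decide
        exact this j))
    exact hT _ _ _ h hww hzw

/-- A split-free graph in the class containing a five-cycle has a bounded branch tree. -/
theorem branchTree_of_pentagon [Finite V] (hs : SplitFree G) (hc : 4 ≤ Nat.card V) :
    BranchTree (CutBound G (60 + 2 ^ 60)) univ := by
  classical
  have : Nonempty V := ⟨p 0⟩
  have hdom : ∀ x, ∃ i, G.Adj x (p i) := by
    have := hs.eq_univ_of_closed hc (X := {x | ∃ i, G.Adj x (p i)}) ⟨p 0, 1, hp 0⟩ (by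
      rintro x ⟨i, hx⟩ y hxy
      by_contra hy
      have hy : ∀ i, ¬ G.Adj y (p i) := fun i h => hy ⟨i, h⟩
      exact not_adj_of_far hT hE hp hy hx hxy)
    exact fun x => eq_univ_iff_forall.1 this x
  have hclass : ∀ x, ∃ t : ZMod 5 × Bool,
      (t.2 = true → IsPendant G p t.1 x) ∧ (t.2 = false → IsCopy G p t.1 x) := by
    intro x
    obtain ⟨i, hi⟩ := hdom x
    rcases isCopy_or_isPendant hT hp hi with h | h | h
    · exact ⟨(i, true), by simpa using h⟩
    · exact ⟨(i + 1, false), by simpa using h⟩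
    · exact ⟨(i - 1, false), by simpa using h⟩
  choose τ hτW hτV using hclass
  let kind : V → Fin 3 := fun x =>
    if (τ x).2 = true then 1 else if DeviatesUp G p (τ x).1 x then 0 else 2
  -- Block `i` holds the pendants at `i`, the copies of `i + 2` deviating upwards, and the copies of
  -- `i - 2` not deviating upwards: the only vertices between which deviations involving these
  -- pendants or these copies can occur.
  let blk : V → ZMod 5 := fun x =>
    if (τ x).2 = true then (τ x).1 else if DeviatesUp G p (τ x).1 x then (τ x).1 - 2
      else (τ x).1 + 2
  have hW : ∀ x, (τ x).2 = true → IsPendant G p (τ x).1 x ∧ kind x = 1 ∧ blk x = (τ x).1 :=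
    fun x h => ⟨hτW x h, by simp [kind, h], by simp [blk, h]⟩
  have hX : ∀ x, (τ x).2 = false → DeviatesUp G p (τ x).1 x →
      IsCopy G p (τ x).1 x ∧ kind x = 0 ∧ blk x = (τ x).1 - 2 :=
    fun x h h' => ⟨hτV x h, by simp [kind, h, h'], by simp [blk, h, h']⟩
  have hY : ∀ x, (τ x).2 = false → ¬ DeviatesUp G p (τ x).1 x →
      IsCopy G p (τ x).1 x ∧ kind x = 2 ∧ blk x = (τ x).1 + 2 :=
    fun x h h' => ⟨hτV x h, by simp [kind, h, h'], by simp [blk, h, h']⟩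
  -- vertices of the three kinds
  have k0 : ∀ x, kind x = 0 → IsCopy G p (blk x + 2) x := by
    intro x hx
    cases h : (τ x).2
    · by_cases hd : DeviatesUp G p (τ x).1 x
      · rw [(hX x h hd).2.2, sub_add_cancel]
        exact hτV x h
      · simp [(hY x h hd).2.1] at hx
    · simp [(hW x h).2.1] at hx
  have k1 : ∀ x, kind x = 1 → IsPendant G p (blk x) x := by
    intro x hx
    cases h : (τ x).2
    · by_cases hd : DeviatesUp G p (τ x).1 x
      · simp [(hX x h hd).2.1] at hx
      · simp [(hY x h hd).2.1] at hx
    · rw [(hW x h).2.2]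
      exact hτW x h
  have k2 : ∀ x, kind x = 2 → IsCopy G p (blk x - 2) x := by
    intro x hx
    cases h : (τ x).2
    · by_cases hd : DeviatesUp G p (τ x).1 x
      · simp [(hX x h hd).2.1] at hx
      · rw [(hY x h hd).2.2, add_sub_cancel_right]
        exact hτV x h
    · simp [(hW x h).2.1] at hx
  have three : ∀ i : ZMod 5, i + 3 = i - 2 := by decide
  have chain01 : ∀ x x' y y', blk x = blk x' → blk x = blk y → blk x = blk y' → kind x = 0 →
      kind x' = 0 → kind y = 1 → kind y' = 1 → G.Adj x y → G.Adj x' y' →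
      G.Adj x y' ∨ G.Adj x' y := by
    intro x x' y y' hb1 hb2 hb3 hx hx' hy hy'
    have a1 := k0 x hx
    have a2 := k0 x' hx'
    have a3 := k1 y hy
    have a4 := k1 y' hy'
    rw [← hb1] at a2
    rw [← hb2, ← add_zero (blk x)] at a3
    rw [← hb3, ← add_zero (blk x)] at a4
    exact pendant_chain hT hE (pentagon_rotate hp (blk x)) (isCopy_rotate.2 a1)
      (isCopy_rotate.2 a2) (isPendant_rotate.2 a3) (isPendant_rotate.2 a4)
  have chain21 : ∀ x x' y y', blk x = blk x' → blk x = blk y → blk x = blk y' → kind x = 2 →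
      kind x' = 2 → kind y = 1 → kind y' = 1 → G.Adj x y → G.Adj x' y' →
      G.Adj x y' ∨ G.Adj x' y := by
    intro x x' y y' hb1 hb2 hb3 hx hx' hy hy'
    have a1 := k2 x hx
    have a2 := k2 x' hx'
    have a3 := k1 y hy
    have a4 := k1 y' hy'
    rw [← hb1] at a2
    rw [← hb2, ← sub_zero (blk x)] at a3
    rw [← hb3, ← sub_zero (blk x)] at a4
    exact pendant_chain hT hE (pentagon_reflect hp (blk x)) (isCopy_reflect.2 a1)
      (isCopy_reflect.2 a2) (isPendant_reflect.2 a3) (isPendant_reflect.2 a4)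
  have chain02 : ∀ x x' y y', blk x = blk x' → blk x = blk y → blk x = blk y' → kind x = 0 →
      kind x' = 0 → kind y = 2 → kind y' = 2 → G.Adj x y → G.Adj x' y' →
      G.Adj x y' ∨ G.Adj x' y := by
    intro x x' y y' hb1 hb2 hb3 hx hx' hy hy'
    have a1 := k0 x hx
    have a2 := k0 x' hx'
    have a3 := k2 y hy
    have a4 := k2 y' hy'
    rw [← hb1] at a2
    rw [← hb2, ← three] at a3
    rw [← hb3, ← three] at a4
    exact copies_chain hT hE (pentagon_rotate hp (blk x)) (isCopy_rotate.2 a1)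
      (isCopy_rotate.2 a2) (isCopy_rotate.2 a3) (isCopy_rotate.2 a4)
  -- deviations from the basic adjacencies occur only within blocks
  have up : ∀ a b, (τ a).2 = false → (τ b).2 = false → (τ b).1 = (τ a).1 + 1 → ¬ G.Adj a b →
      blk a = blk b ∧ kind a ≠ kind b := by
    intro a b ha hb hab hn
    have hda : DeviatesUp G p (τ a).1 a := .inl ⟨b, hab ▸ hτV b hb, hn⟩
    have hdb : ¬ DeviatesUp G p (τ b).1 b := fun hd =>
      hn ((not_adj_of_deviatesUp hT hE hp (hτV b hb) hd).1 a
        (by rw [hab, add_sub_cancel_right]; exact hτV a ha))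
    obtain ⟨-, e1, e2⟩ := hX a ha hda
    obtain ⟨-, e3, e4⟩ := hY b hb hdb
    refine ⟨?_, by rw [e1, e3]; decide⟩
    rw [e2, e4, hab, ← three]
    ring
  have cross : ∀ a b, (τ a).2 = true → (τ b).2 = false → (τ a).1 ≠ (τ b).1 → G.Adj a b →
      blk a = blk b ∧ kind a ≠ kind b := by
    intro a b ha hb hne hab
    have key : ∀ i j : ZMod 5, i ≠ j → j = i + 1 ∨ j = i - 1 ∨ i = j - 2 ∨ i = j + 2 := by decide
    obtain ⟨pa, e1, e2⟩ := hW a ha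
    have pb := hτV b hb
    rcases key _ _ hne with h | h | h | h
    · exact (pb.not_adj_pendant hT pa (.inl h) hab.symm).elim
    · exact (pb.not_adj_pendant hT pa (.inr h) hab.symm).elim
    · obtain ⟨-, e3, e4⟩ := hX b hb (.inr ⟨a, h ▸ pa, hab.symm⟩)
      exact ⟨by rw [e2, e4, h], by rw [e1, e3]; decide⟩
    · have hdb : ¬ DeviatesUp G p (τ b).1 b := fun hd =>
        (not_adj_of_deviatesUp hT hE hp pb hd).2 a (h ▸ pa) hab.symm
      obtain ⟨-, e3, e4⟩ := hY b hb hdb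
      exact ⟨by rw [e2, e4, h], by rw [e1, e3]; decide⟩
  -- The ideal pattern: copies among themselves and pendants among themselves follow the cycle, and
  -- a copy sees the pendants at its own position only.
  let β : ZMod 5 × Bool → ZMod 5 × Bool → Prop := fun s t =>
    if s.2 = t.2 then t.1 = s.1 + 1 ∨ s.1 = t.1 + 1 else s.1 = t.1
  have hβ_symm : ∀ s t, β s t ↔ β t s := by
    intro s t
    by_cases h : s.2 = t.2
    · simp only [β, h, if_true, or_comm]
    · simp only [β, h, Ne.symm h, if_false, eq_comm]
  have outside : ∀ a b, ¬ (blk a = blk b ∧ kind a ≠ kind b) → (G.Adj a b ↔ β (τ a) (τ b)) := by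
    intro a b hab
    have hba : ¬ (blk b = blk a ∧ kind b ≠ kind a) := fun h => hab ⟨h.1.symm, h.2.symm⟩
    cases ha : (τ a).2 <;> cases hb : (τ b).2
    · simp only [β, ha, hb, if_true]
      constructor
      · intro h
        by_contra! hn
        exact (hτV a ha).not_adj_copy hT (hτV b hb) hn.1 hn.2 h
      · rintro (h | h) <;> by_contra hn
        · exact hab (up a b ha hb h hn)
        · exact hba (up b a hb ha h fun h => hn h.symm)
    · simp only [β, ha, hb, Bool.false_eq_true, if_false]
      constructor
      · intro h
        by_contra hn
        exact hba (cross b a hb ha (Ne.symm hn) h.symm)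
      · intro h
        exact adj_copy_pendant hT hE hp (hτV a ha) (h ▸ hτW b hb)
    · simp only [β, ha, hb, Bool.true_eq_false, if_false]
      constructor
      · intro h
        by_contra hn
        exact hab (cross a b ha hb hn h)
      · intro h
        exact (adj_copy_pendant hT hE hp (hτV b hb) (h ▸ hτW a ha)).symm
    · simp only [β, ha, hb, if_true]
      exact adj_pendants_iff hT hE hp (hτW a ha) (hτW b hb)
  have inside : ∀ a b, blk a = blk b → kind a < kind b →
      (β (τ a) (τ b) ↔ ¬ (kind a = 1 ∨ kind b = 1)) := by
    intro a b hab hk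
    have n1 : ∀ i j : ZMod 5, i - 2 = j → i ≠ j := by decide
    have n2 : ∀ i j : ZMod 5, i = j + 2 → i ≠ j := by decide
    have n3 : ∀ i j : ZMod 5, i - 2 = j + 2 → j = i + 1 := by decide
    cases ha : (τ a).2 <;> cases hb : (τ b).2
    · by_cases hda : DeviatesUp G p (τ a).1 a <;> by_cases hdb : DeviatesUp G p (τ b).1 b
      · rw [(hX a ha hda).2.1, (hX b hb hdb).2.1] at hk
        exact (lt_irrefl _ hk).elim
      · rw [(hX a ha hda).2.2, (hY b hb hdb).2.2] at hab
        rw [(hX a ha hda).2.1, (hY b hb hdb).2.1]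
        simp [β, ha, hb, n3 _ _ hab]
      · rw [(hY a ha hda).2.1, (hX b hb hdb).2.1] at hk
        exact absurd hk (by decide)
      · rw [(hY a ha hda).2.1, (hY b hb hdb).2.1] at hk
        exact (lt_irrefl _ hk).elim
    · rw [(hW b hb).2.2] at hab
      by_cases hda : DeviatesUp G p (τ a).1 a
      · rw [(hX a ha hda).2.2] at hab
        simp [β, ha, hb, n1 _ _ hab, (hW b hb).2.1]
      · rw [(hY a ha hda).2.1, (hW b hb).2.1] at hk
        exact absurd hk (by decide)
    · rw [(hW a ha).2.2] at hab
      by_cases hdb : DeviatesUp G p (τ b).1 b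
      · rw [(hX b hb hdb).2.1, (hW a ha).2.1] at hk
        exact absurd hk (by decide)
      · rw [(hY b hb hdb).2.2] at hab
        simp [β, ha, hb, n2 _ _ hab, (hW a ha).2.1]
    · rw [(hW a ha).2.1, (hW b hb).2.1] at hk
      exact (lt_irrefl _ hk).elim
  -- The deviations are nonadjacent pairs of copies and adjacent copy-pendant pairs. The bound is
  -- `60 = 10 * 3 * 2`.
  refine branchTree_of_blocks G (κ := ZMod 5 × Bool) (m := 60) ?_ blk kind τ
    (fun x y => blk x = blk y ∧ kind x ≠ kind y ∧ (G.Adj x y ↔ kind x = 1 ∨ kind y = 1)) β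
    ?_ (fun a b h => ⟨h.1, h.2.1⟩) ?_ ?_ ?_
  · simp [ZMod.card]
  · rintro a b ⟨h1, h2, h3⟩
    exact ⟨h1.symm, h2.symm, by rw [G.adj_comm, h3, or_comm]⟩
  · rintro x x' y y' hb1 hb2 hb3 hx hy hxy ⟨-, -, h1⟩ ⟨-, -, h2⟩
    have hsame : blk x' = blk y := hb1.symm.trans hb2
    simp only [hb3, hsame, ← hx, ← hy, hxy, ne_eq, not_false_iff, true_and]
    rw [← hx, ← hy] at h2
    have hk : ∀ k : Fin 3, k = 0 ∨ k = 1 ∨ k = 2 := by decide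
    have c1 := chain01 x x' y y' hb1 hb2 hb3
    have c2 := chain21 x x' y y' hb1 hb2 hb3
    -- Between copies the deviations are nonedges, so the chain property is used in contrapositive
    -- form, with `y` and `y'` exchanged.
    have c3 := chain02 x x' y' y hb1 hb3 hb2
    have d1 := chain01 y y' x x' (hb2.symm.trans hb3) hb2.symm (hb2.symm.trans hb1)
    have d2 := chain21 y y' x x' (hb2.symm.trans hb3) hb2.symm (hb2.symm.trans hb1)
    have d3 := chain02 y y' x' x (hb2.symm.trans hb3) (hb2.symm.trans hb1) hb2.symm
    rw [← hx, ← hy] at c1 c2 c3 d1 d2 d3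
    simp only [G.adj_comm y, G.adj_comm y'] at d1 d2 d3
    rcases hk (kind x) with ex | ex | ex <;> rcases hk (kind y) with ey | ey | ey <;>
      simp [ex, ey] at hxy h1 h2 c1 c2 c3 d1 d2 d3 ⊢ <;> tauto
  · intro x w y hb1 hb2 hx hw hy
    have a1 := k0 x hx
    have a2 := k1 w hw
    have a3 := k2 y hy
    rw [← hb1, ← add_zero (blk x)] at a2
    rw [← hb2, ← three] at a3
    have hb3 : blk w = blk y := hb1.symm.trans hb2
    -- This fork lemma excludes one cyclic orientation of `x, w, y`; triangle-freeness excludes the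
    -- other.
    have := adj_or_adj_pendant hT hE (pentagon_rotate hp (blk x)) (isCopy_rotate.2 a1)
      (isCopy_rotate.2 a3) (isPendant_rotate.2 a2)
    have hT' := hT x w y
    have hw' := G.adj_comm y w
    simp [hb1, hb3, hx, hw, hy]
    tauto
  · intro a b hab
    by_cases hδ : blk a = blk b ∧ kind a ≠ kind b
    · have hin : β (τ a) (τ b) ↔ ¬ (kind a = 1 ∨ kind b = 1) := by
        rcases lt_or_gt_of_ne hδ.2 with h | h
        · exact inside a b hδ.1 h
        · rw [hβ_symm, or_comm]
          exact inside b a hδ.1.symm h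
      rw [hin]
      tauto
    · rw [outside a b hδ]
      tauto

end PentagonStructure

/-! ### Recognising induced cycles and paths. -/

section LongHole

open Set

variable {V : Type*} {G : SimpleGraph V}

/-- Injectivity comes for free: for `n ≥ 5`, the prescribed adjacencies already distinguish any two
positions. -/
theorem isHole_of_nat {n : ℕ} (hn : 5 ≤ n) (P : ℕ → V)
    (hP : ∀ i j, i < j → j < n → (G.Adj (P i) (P j) ↔ j = i + 1 ∨ i = 0 ∧ j + 1 = n)) :
    IsHole G (fun i : ZMod n => P i.val) := by
  have : NeZero n := ⟨by omega⟩
  have : Fact (1 < n) := ⟨by omega⟩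
  have hinj : ∀ i j, i < j → j < n → P i ≠ P j := by
    intro i j hij hj h
    by_cases hj' : j + 1 = n
    · by_cases hi : i + 1 = j
      · have := (hP i j hij hj).2 (.inl hi.symm)
        rw [h] at this
        exact G.irrefl this
      · have h1 := (hP (j - 1) j (by omega) hj).2 (by omega)
        have h2 := (hP i (j - 1) (by omega) (by omega)).1 (h ▸ h1.symm)
        have h3 := (hP (i - 1) i (by omega) (by omega)).2 (by omega)
        have h4 := (hP (i - 1) j (by omega) hj).1 (h ▸ h3)
        omega
    · have h1 := (hP j (j + 1) (by omega) (by omega)).2 (.inl rfl)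
      have h2 := (hP i (j + 1) (by omega) (by omega)).1 (h ▸ h1)
      have h3 := (hP i (i + 1) (by omega) (by omega)).2 (.inl rfl)
      by_cases hij' : i + 1 = j
      · rw [hij', h] at h3
        exact G.irrefl h3
      · have h4 := (hP (i + 1) j (by omega) (by omega)).1 (h ▸ h3.symm)
        omega
  have hsucc : ∀ i j : ZMod n, j = i + 1 ↔ j.val = i.val + 1 ∨ j.val = 0 ∧ i.val + 1 = n := by
    intro i j
    have hi := i.val_lt
    have hj := j.val_lt
    rw [← (ZMod.val_injective n).eq_iff, ZMod.val_add, ZMod.val_one]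
    by_cases h : i.val + 1 = n
    · rw [h, Nat.mod_self]
      omega
    · rw [Nat.mod_eq_of_lt (by omega)]
      omega
  refine ⟨fun i j hij => ZMod.val_injective n ?_, fun i j => ?_⟩
  · by_contra hne
    rcases lt_or_gt_of_ne hne with h | h
    · exact hinj _ _ h j.val_lt hij
    · exact hinj _ _ h i.val_lt hij.symm
  · have hi := i.val_lt
    have hj := j.val_lt
    rw [hsucc, hsucc]
    rcases lt_trichotomy i.val j.val with h | h | h
    · rw [hP _ _ h hj]
      omega
    · obtain rfl := ZMod.val_injective n h
      exact iff_of_false G.irrefl (by omega)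
    · rw [G.adj_comm, hP _ _ h hi]
      omega

/-- Two vertices connected within `R` are connected by an induced path within `R`. -/
theorem exists_induced_path {R : Set V} {a b : R} (h : (G.induce R).Reachable a b) :
    ∃ (r : ℕ) (q : ℕ → V), q 0 = a ∧ q r = b ∧ (∀ i, q i ∈ R) ∧
      ∀ i j, i < j → j ≤ r → q i ≠ q j ∧ (G.Adj (q i) (q j) ↔ j = i + 1) := by
  obtain ⟨p, hp⟩ := h.exists_walk_length_eq_dist
  have hd : ∀ i, i ≤ p.length → (G.induce R).dist a (p.getVert i) = i := by
    intro i hi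
    have h1 := (G.induce R).dist_le (p.take i)
    have h2 := (G.induce R).dist_le (p.drop i)
    have h3 : (G.induce R).dist a b ≤ (G.induce R).dist a (p.getVert i) + (p.drop i).length := by
      obtain ⟨p', hp'⟩ := (p.take i).reachable.exists_walk_length_eq_dist
      have := (G.induce R).dist_le (p'.append (p.drop i))
      rw [SimpleGraph.Walk.length_append] at this
      omega
    rw [SimpleGraph.Walk.take_length] at h1
    rw [SimpleGraph.Walk.drop_length] at h3
    omega
  refine ⟨p.length, fun i => p.getVert i, by simp, by simp, fun i => (p.getVert i).2,
    fun i j hij hj => ⟨fun h => ?_, fun h => ?_, ?_⟩⟩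
  · have h1 := hd i (by omega)
    have h2 := hd j hj
    rw [Subtype.ext h] at h1
    omega
  · have h1 := hd i (by omega)
    have h2 := hd j hj
    obtain ⟨p', hp'⟩ := (p.take i).reachable.exists_walk_length_eq_dist
    have hadj : (G.induce R).Adj (p.getVert i) (p.getVert j) := h
    have := (G.induce R).dist_le (p'.concat hadj)
    rw [SimpleGraph.Walk.length_concat] at this
    omega
  · rintro rfl
    exact p.adj_getVert_succ (by omega)

end LongHole

/-! ### Distance layers from a root in a pentagon-free graph. -/

section Layers

open Set

variable {V : Type*} {G : SimpleGraph V} {u : V}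

/-- The vertices at distance two from `u`. -/
def SecondLayer (G : SimpleGraph V) (u w : V) : Prop :=
  w ≠ u ∧ ¬ G.Adj u w ∧ ∃ x, G.Adj u x ∧ G.Adj x w

/-- The vertices at distance more than two from `u`. -/
def FarFrom (G : SimpleGraph V) (u y : V) : Prop :=
  y ≠ u ∧ ¬ G.Adj u y ∧ ¬ SecondLayer G u y

/-- The neighbours of `u` which are not neighbours of `w`. -/
def Missing (G : SimpleGraph V) (u w x : V) : Prop :=
  G.Adj u x ∧ ¬ G.Adj w x

/-- Some neighbour of `u` is adjacent neither to `w` nor to `w'`. -/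
def Meets (G : SimpleGraph V) (u w w' : V) : Prop :=
  ∃ x, Missing G u w x ∧ Missing G u w' x

theorem Meets.symm {w w' : V} (h : Meets G u w w') : Meets G u w' w := by
  obtain ⟨x, h1, h2⟩ := h
  exact ⟨x, h2, h1⟩

theorem FarFrom.not_adj {x y : V} (hy : FarFrom G u y) (hx : G.Adj u x) : ¬ G.Adj x y :=
  fun h => hy.2.2 ⟨hy.1, hy.2.1, x, hx, h⟩

theorem SecondLayer.not_adj (h5 : PentagonFree G) {w w' : V}
    (hw : SecondLayer G u w) (hw' : SecondLayer G u w') : ¬ G.Adj w w' := by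
  obtain ⟨-, -, x, hx, hxw⟩ := hw
  obtain ⟨-, -, x', hx', hxw'⟩ := hw'
  exact fun h => h5 u x w w' x' hx hxw h hxw'.symm hx'.symm

/-- If neither set contained the other, a common missed neighbour would be the pendant vertex of a
fork centred at `u` whose arms end in `w` and `w'`, making these adjacent. -/
theorem Meets.comparable (hE : ForkFree G) (h5 : PentagonFree G) {w w' : V}
    (hw : SecondLayer G u w) (hw' : SecondLayer G u w') (h : Meets G u w w') :
    (∀ x, Missing G u w x → Missing G u w' x) ∨ ∀ x, Missing G u w' x → Missing G u w x := by
  by_contra! hn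
  obtain ⟨⟨x, hx, hxn⟩, x', hx', hxn'⟩ := hn
  obtain ⟨z, hz, hz'⟩ := h
  have h1 : G.Adj w' x := by
    by_contra h
    exact hxn ⟨hx.1, h⟩
  have h2 : G.Adj w x' := by
    by_contra h
    exact hxn' ⟨hx'.1, h⟩
  exact hw.not_adj h5 hw' (hE u z x' w x w' hz.1 hx'.1 hx.1 h2.symm h1.symm
    (fun h => hz.2 h.symm) (fun h => hz'.2 h.symm) (fun h => hx'.2 h.symm) fun h => hx.2 h.symm)

/-- If the outer missing sets were disjoint, both would lie in the middle one. A common neighbour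
`c` of `u` and `w₂` then sees all three vertices, and the fork centred at `c` yields a triangle at
`u`. -/
theorem Meets.trans (hT : TriangleFree G) (hE : ForkFree G) (h5 : PentagonFree G) {w₁ w₂ w₃ : V}
    (hw₁ : SecondLayer G u w₁) (hw₂ : SecondLayer G u w₂) (hw₃ : SecondLayer G u w₃)
    (h : Meets G u w₁ w₂) (h' : Meets G u w₂ w₃) : Meets G u w₁ w₃ := by
  by_contra hn
  obtain ⟨x, hx1, hx2⟩ := h
  obtain ⟨x', hx2', hx3'⟩ := h'
  have hx3 : ¬ Missing G u w₃ x := fun h => hn ⟨x, hx1, h⟩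
  have hx1' : ¬ Missing G u w₁ x' := fun h => hn ⟨x', h, hx3'⟩
  have h12 := (Meets.comparable hE h5 hw₁ hw₂ ⟨x, hx1, hx2⟩).resolve_right
    fun h => hx1' (h x' hx2')
  have h32 := (Meets.comparable hE h5 hw₂ hw₃ ⟨x', hx2', hx3'⟩).resolve_left
    fun h => hx3 (h x hx2)
  obtain ⟨-, -, c, hc, hcw⟩ := hw₂
  have a1 : G.Adj w₁ c := by
    by_contra h
    exact (h12 c ⟨hc, h⟩).2 hcw.symm
  have a3 : G.Adj w₃ c := by
    by_contra h
    exact (h32 c ⟨hc, h⟩).2 hcw.symm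
  have b1 : G.Adj w₁ x' := by
    by_contra h
    exact hx1' ⟨hx2'.1, h⟩
  have b3 : G.Adj w₃ x := by
    by_contra h
    exact hx3 ⟨hx2.1, h⟩
  exact hT _ _ _ hx2'.1.symm hx2.1 (hE c w₂ w₁ x' w₃ x hcw a1.symm a3.symm b1 b3 hx2'.2 hx2.2 hx1.2 hx3'.2)

/-- Nested missing sets leave a common neighbour `x` of `u`, `w` and `w'`; the fork centred at `x`
would join `y` to a neighbour of `u`. -/
theorem Meets.adj_far (hE : ForkFree G) (h5 : PentagonFree G) {w w' y : V}
    (hw : SecondLayer G u w) (hw' : SecondLayer G u w') (h : Meets G u w w')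
    (hy : FarFrom G u y) (hwy : G.Adj w y) : G.Adj w' y := by
  by_contra hn
  obtain ⟨x', hx, hx'⟩ := id h
  obtain ⟨x, hx0, hxw, hxw'⟩ : ∃ x, G.Adj u x ∧ G.Adj x w ∧ G.Adj x w' := by
    rcases h.comparable hE h5 hw hw' with hc | hc
    · obtain ⟨-, -, x, hx, hxw⟩ := hw'
      refine ⟨x, hx, ?_, hxw⟩
      by_contra h
      exact (hc x ⟨hx, fun h' => h h'.symm⟩).2 hxw.symm
    · obtain ⟨-, -, x, hx, hxw⟩ := hw
      refine ⟨x, hx, hxw, ?_⟩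
      by_contra h
      exact (hc x ⟨hx, fun h' => h h'.symm⟩).2 hxw.symm
  exact hy.not_adj hx.1 (hE x w' w y u x' hxw' hxw hx0.symm hwy hx.1 hn hx'.2 hx.2 hy.2.1).symm

/-- The hypotheses on the root vertex of a layering. -/
structure Layering (G : SimpleGraph V) (u : V) : Prop where
  triangleFree : TriangleFree G
  forkFree : ForkFree G
  pentagonFree : PentagonFree G
  exists_missing : ∀ w, SecondLayer G u w → ∃ x, Missing G u w x
  eq_of_twins : ∀ p q, (∀ y, G.Adj p y ↔ G.Adj q y) → p = q

namespace Layering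

variable (h : Layering G u)

include h

theorem adj_far_iff {w w' y z : V} (hw : SecondLayer G u w) (hw' : SecondLayer G u w')
    (hy : FarFrom G u y) (hwy : G.Adj w y) (hwy' : G.Adj w' y) (hz : FarFrom G u z)
    (hwz : G.Adj w z) : G.Adj w' z := by
  by_contra hn
  have hsub : ∀ x, Missing G u w' x → Missing G u w x := by
    intro x hx
    refine ⟨hx.1, fun hwx => hw'.2.1 ?_⟩
    exact h.forkFree w z x u y w' hwz hwx hwy hx.1.symm hwy'.symm
      (fun e => hz.2.1 e.symm) (fun e => hn e.symm) (fun e => hx.2 e.symm)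
      (fun e => hy.2.1 e.symm)
  obtain ⟨x, hx⟩ := h.exists_missing w' hw'
  exact hn (Meets.adj_far h.forkFree h.pentagonFree hw hw' ⟨x, hsub x hx, hx⟩ hz hwz)

/-- Two far neighbours of `w` are shown to be twins. -/
theorem far_unique {w y z : V} (hw : SecondLayer G u w) (hy : FarFrom G u y) (hz : FarFrom G u z)
    (hwy : G.Adj w y) (hwz : G.Adj w z) : y = z := by
  have half : ∀ y z, FarFrom G u y → FarFrom G u z → G.Adj w y → G.Adj w z →
      ∀ s, G.Adj y s → G.Adj z s := by
    intro y z hy hz hwy hwz s hys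
    by_cases hsu : s = u
    · exact (hy.2.1 (hsu ▸ hys.symm)).elim
    by_cases hs1 : G.Adj u s
    · exact (hy.not_adj hs1 hys.symm).elim
    by_cases hs2 : SecondLayer G u s
    · exact (h.adj_far_iff hw hs2 hy hwy hys.symm hz hwz).symm
    · have hs : FarFrom G u s := ⟨hsu, hs1, hs2⟩
      by_contra hn
      obtain ⟨-, -, x, hx, hxw⟩ := hw
      exact hs1 (h.forkFree w z x u y s hwz hxw.symm hwy hx.symm hys (fun e => hz.2.1 e.symm) hn
        (hs.not_adj hx) fun e => hy.2.1 e.symm)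
  exact h.eq_of_twins y z fun s => ⟨half y z hy hz hwy hwz s, half z y hz hy hwz hwy s⟩

/-- A common neighbour `x` would force the edge `y₁ y₂` and so a pentagon; a commonly missed one
would give `w₁` and `w₂` the same far neighbours. -/
theorem adj_iff_not_adj {w₁ w₂ y₁ y₂ x : V} (hw₁ : SecondLayer G u w₁)
    (hw₂ : SecondLayer G u w₂) (hy₁ : FarFrom G u y₁) (hy₂ : FarFrom G u y₂)
    (h1 : G.Adj w₁ y₁) (h2 : G.Adj w₂ y₂) (hne : y₁ ≠ y₂) (hx : G.Adj u x) :
    G.Adj w₁ x ↔ ¬ G.Adj w₂ x := by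
  have n12 : ¬ G.Adj w₁ y₂ := fun e => hne (h.far_unique hw₁ hy₁ hy₂ h1 e)
  have n21 : ¬ G.Adj w₂ y₁ := fun e => hne (h.far_unique hw₂ hy₁ hy₂ e h2)
  constructor
  · intro e1 e2
    have := h.forkFree x u w₁ y₁ w₂ y₂ hx.symm e1.symm e2.symm h1 h2 hy₁.2.1 hy₂.2.1 n12 n21
    exact h.pentagonFree x w₁ y₁ y₂ w₂ e1.symm h1 this h2.symm e2
  · intro e2
    by_contra e1
    exact n21 (Meets.adj_far h.forkFree h.pentagonFree hw₁ hw₂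
      ⟨x, ⟨hx, e1⟩, ⟨hx, e2⟩⟩ hy₁ h1)

theorem near_unique {w₁ w₁' w₂ y₁ y₂ : V} (hw₁ : SecondLayer G u w₁) (hw₁' : SecondLayer G u w₁')
    (hw₂ : SecondLayer G u w₂) (hy₁ : FarFrom G u y₁) (hy₂ : FarFrom G u y₂)
    (h1 : G.Adj w₁ y₁) (h1' : G.Adj w₁' y₁) (h2 : G.Adj w₂ y₂) (hne : y₁ ≠ y₂) : w₁ = w₁' := by
  refine h.eq_of_twins _ _ fun s => ?_
  by_cases hsu : s = u
  · subst hsu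
    exact iff_of_false (fun e => hw₁.2.1 e.symm) fun e => hw₁'.2.1 e.symm
  by_cases hs1 : G.Adj u s
  · rw [h.adj_iff_not_adj hw₁ hw₂ hy₁ hy₂ h1 h2 hne hs1,
      h.adj_iff_not_adj hw₁' hw₂ hy₁ hy₂ h1' h2 hne hs1]
  by_cases hs2 : SecondLayer G u s
  · exact iff_of_false (hw₁.not_adj h.pentagonFree hs2)
      (hw₁'.not_adj h.pentagonFree hs2)
  · have hs : FarFrom G u s := ⟨hsu, hs1, hs2⟩
    exact ⟨h.adj_far_iff hw₁ hw₁' hy₁ h1 h1' hs, h.adj_far_iff hw₁' hw₁ hy₁ h1' h1 hs⟩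

/-- Three subsets of the nonempty neighbourhood of `u` cannot be pairwise complementary. -/
theorem far_eq_or_eq {w₁ w₂ w₃ y₁ y₂ y₃ : V} (hw₁ : SecondLayer G u w₁)
    (hw₂ : SecondLayer G u w₂) (hw₃ : SecondLayer G u w₃) (hy₁ : FarFrom G u y₁)
    (hy₂ : FarFrom G u y₂) (hy₃ : FarFrom G u y₃) (h1 : G.Adj w₁ y₁) (h2 : G.Adj w₂ y₂)
    (h3 : G.Adj w₃ y₃) (hne : y₁ ≠ y₂) : y₃ = y₁ ∨ y₃ = y₂ := by
  by_contra! hn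
  obtain ⟨-, -, x, hx, -⟩ := id hw₁
  have a := h.adj_iff_not_adj hw₁ hw₂ hy₁ hy₂ h1 h2 hne hx
  have b := h.adj_iff_not_adj hw₁ hw₃ hy₁ hy₃ h1 h3 hn.1.symm hx
  have c := h.adj_iff_not_adj hw₂ hw₃ hy₂ hy₃ h2 h3 hn.2.symm hx
  tauto

/-- An induced far path from `y₁` to `y₂` closes up through `w₂, x₂, u, x₁, w₁`. It has `r + 1 ≥ 2`
vertices, so the cycle has length `r + 6 ≥ 7`. -/
theorem exists_hole {w₁ w₂ y₁ y₂ : V} (hw₁ : SecondLayer G u w₁)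
    (hw₂ : SecondLayer G u w₂) (hy₁ : FarFrom G u y₁) (hy₂ : FarFrom G u y₂)
    (h1 : G.Adj w₁ y₁) (h2 : G.Adj w₂ y₂) (hne : y₁ ≠ y₂)
    (hr : (G.induce {y | FarFrom G u y}).Reachable ⟨y₁, hy₁⟩ ⟨y₂, hy₂⟩) :
    ∃ n, 7 ≤ n ∧ ∃ p : ZMod n → V, IsHole G p := by
  obtain ⟨r, q, hq0, hqr, hqR, hq⟩ := exists_induced_path hr
  have hqR : ∀ i, FarFrom G u (q i) := hqR
  have hr0 : 1 ≤ r := by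
    by_contra h0
    obtain rfl : r = 0 := by omega
    exact hne (hq0.symm.trans hqr)
  obtain ⟨-, -, x₁, hx₁, hxw₁⟩ := id hw₁
  obtain ⟨-, -, x₂, hx₂, hxw₂⟩ := id hw₂
  have hx₁₂ := h.adj_iff_not_adj hw₁ hw₂ hy₁ hy₂ h1 h2 hne hx₁
  have hx₂₁ := h.adj_iff_not_adj hw₁ hw₂ hy₁ hy₂ h1 h2 hne hx₂
  have hxx : ¬ G.Adj x₂ x₁ := h.triangleFree _ _ _ hx₂.symm hx₁
  have hww : ¬ G.Adj w₂ w₁ := hw₂.not_adj h.pentagonFree hw₁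
  have hqw₂ : ∀ i, i ≤ r → (G.Adj (q i) w₂ ↔ i = r) := by
    intro i hi
    constructor
    · intro e
      by_contra hlt
      exact (hq i r (by omega) le_rfl).1
        ((h.far_unique hw₂ (hqR i) hy₂ e.symm h2).trans hqr.symm)
    · rintro rfl
      rw [hqr]
      exact h2.symm
  have hqw₁ : ∀ i, i ≤ r → (G.Adj (q i) w₁ ↔ i = 0) := by
    intro i hi
    constructor
    · intro e
      by_contra hlt
      exact (hq 0 i (by omega) hi).1
        (hq0.trans (h.far_unique hw₁ hy₁ (hqR i) h1 e.symm))
    · rintro rfl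
      rw [hq0]
      exact h1.symm
  have e1 : ∀ i, ¬ G.Adj (q i) x₁ := fun i e => (hqR i).not_adj hx₁ e.symm
  have e2 : ∀ i, ¬ G.Adj (q i) x₂ := fun i e => (hqR i).not_adj hx₂ e.symm
  have e3 : ∀ i, ¬ G.Adj (q i) u := fun i e => (hqR i).2.1 e.symm
  let P : ℕ → V := fun i => if i ≤ r then q i else if i = r + 1 then w₂ else
    if i = r + 2 then x₂ else if i = r + 3 then u else if i = r + 4 then x₁ else w₁
  have P0 : ∀ i, i ≤ r → P i = q i := fun i hi => by simp [P, hi]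
  have P1 : P (r + 1) = w₂ := by simp [P]
  have P2 : P (r + 2) = x₂ := by simp [P]
  have P3 : P (r + 3) = u := by simp [P]
  have P4 : P (r + 4) = x₁ := by simp [P]
  have P5 : P (r + 5) = w₁ := by simp [P]
  refine ⟨r + 6, by omega, _, isHole_of_nat (by omega) P fun i j hij hj => ?_⟩
  have hcase : ∀ k, k < r + 6 → k ≤ r ∨ k = r + 1 ∨ k = r + 2 ∨ k = r + 3 ∨ k = r + 4 ∨
    k = r + 5 := by omega
  have hwx₂ : ¬ G.Adj w₂ x₁ := hx₁₂.1 hxw₁.symm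
  have hwx₁ : ¬ G.Adj x₂ w₁ := fun e => hx₂₁.1 e.symm hxw₂.symm
  have hu1 : ¬ G.Adj u w₁ := hw₁.2.1
  have hu2 : ¬ G.Adj w₂ u := fun e => hw₂.2.1 e.symm
  rcases hcase i (by omega) with hi | rfl | rfl | rfl | rfl | rfl <;>
    rcases hcase j hj with hj' | rfl | rfl | rfl | rfl | rfl <;>
    first
    | omega
    | (simp only [P0 _ hi, P0 _ hj', (hq i j hij hj').2] <;> omega)
    | (simp only [P0 _ hi, P1, hqw₂ i hi] <;> omega)
    | (simp only [P0 _ hi, P5, hqw₁ i hi, and_true] <;> omega)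
    | (simp only [P0 _ hi, P2, P3, P4, e1, e2, e3, false_iff]; omega)
    | (simp only [P1, P2, P3, P4, P5, hwx₁, hwx₂, hu1, hu2, hxx, hww, false_iff]; omega)
    | simp [P1, P2, P3, P4, P5, hxw₁, hxw₂.symm, hx₁, hx₂.symm]

end Layering

end Layers

/-! ### The case without long induced cycles, and the assembly of all cases. -/

section HoleFree

open Set

variable {V : Type*} {G : SimpleGraph V} {u : V}

/-- In a split-free graph without long holes at most one vertex has distance more than two from
the root of a layering. -/
theorem Layering.far_subsingleton (h : Layering G u) (hs : SplitFree G) (hc : 4 ≤ Nat.card V)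
    (h7 : ∀ n, 7 ≤ n → ∀ p : ZMod n → V, ¬ IsHole G p) :
    {y | FarFrom G u y}.Subsingleton := by
  obtain ⟨x₀, hx₀⟩ : ∃ x, G.Adj u x := by
    by_contra! hn
    have hu := hs.eq_univ_of_closed hc (X := {u}) (singleton_nonempty u)
      (by rintro x rfl y hy; exact (hn y hy).elim)
    have hcard := Set.ncard_univ V
    rw [← hu, Set.ncard_singleton] at hcard
    omega
  have hedge : ∀ y z, FarFrom G u y → ¬ FarFrom G u z → G.Adj y z → SecondLayer G u z := by
    intro y z hy hz hyz
    by_contra hn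
    refine hz ⟨?_, fun hu => hy.not_adj hu hyz.symm, hn⟩
    rintro rfl
    exact hy.2.1 hyz.symm
  by_cases hone : ∀ y₁ y₂ w₁ w₂, FarFrom G u y₁ → FarFrom G u y₂ → SecondLayer G u w₁ →
      SecondLayer G u w₂ → G.Adj w₁ y₁ → G.Adj w₂ y₂ → y₁ = y₂
  -- If only one far vertex has neighbours in the second layer, the far set is one side of a split.
  · refine (hs {y | FarFrom G u y} {y | ∃ w, SecondLayer G u w ∧ G.Adj w y}
      {w | ∃ y, FarFrom G u y ∧ G.Adj y w} ?_).resolve_right ?_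
    · intro a ha b hb
      constructor
      · exact fun hab => ⟨⟨b, hedge a b ha hb hab, hab.symm⟩, a, ha, hab⟩
      · rintro ⟨⟨w, hw, hwa⟩, y, hy, hyb⟩
        rwa [hone a y w b ha hy hw (hedge y b hy hb hyb) hwa hyb.symm]
    · intro hsub
      exact hx₀.ne (hsub (fun hu => hu.1 rfl) fun hx => hx.2.1 hx₀)
  · push Not at hone
    obtain ⟨y₁, y₂, w₁, w₂, hy₁, hy₂, hw₁, hw₂, h1, h2, hne⟩ := hone
    exfalso
    by_cases hr : (G.induce {y | FarFrom G u y}).Reachable ⟨y₁, hy₁⟩ ⟨y₂, hy₂⟩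
    · obtain ⟨n, hn, p, hp⟩ := h.exists_hole hw₁ hw₂ hy₁ hy₂ h1 h2 hne hr
      exact h7 n hn p hp
    -- Two attached far vertices lie in different components of the far set. The component `Q` of
    -- `y₁` meets the rest only through `w₁`, so `insert w₁ Q` is one side of a split.
    let Q : Set V := {v | ∃ hv : FarFrom G u v,
      (G.induce {y | FarFrom G u y}).Reachable ⟨y₁, hy₁⟩ ⟨v, hv⟩}
    have hy₁Q : y₁ ∈ Q := ⟨hy₁, .rfl⟩
    have hfarQ : ∀ a ∈ Q, ∀ b, FarFrom G u b → G.Adj a b → b ∈ Q := by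
      rintro a ⟨ha, hra⟩ b hb hab
      exact ⟨hb, hra.trans (SimpleGraph.Adj.reachable (G := G.induce {y | FarFrom G u y})
        (u := ⟨a, ha⟩) (v := ⟨b, hb⟩) hab)⟩
    have hw₁R : ¬ FarFrom G u w₁ := fun e => e.2.2 hw₁
    have hw₂R : ¬ FarFrom G u w₂ := fun e => e.2.2 hw₂
    have hw₁₂ : w₁ ≠ w₂ := by
      rintro rfl
      exact hne (h.far_unique hw₁ hy₁ hy₂ h1 h2)
    have hcut : ∀ a ∈ insert w₁ Q, ∀ b ∉ insert w₁ Q,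
        G.Adj a b ↔ a ∈ ({w₁} : Set V) ∧ b ∈ {y | G.Adj w₁ y} := by
      rintro a (rfl | ha) b hb
      · simp
      · have haR : FarFrom G u a := ha.1
        have hne' : a ≠ w₁ := by
          rintro rfl
          exact hw₁R haR
        refine iff_of_false (fun hab => ?_) fun e => hne' e.1
        by_cases hbR : FarFrom G u b
        · exact hb (mem_insert_of_mem _ (hfarQ a ha b hbR hab))
        · have hbL := hedge a b haR hbR hab
          rcases h.far_eq_or_eq hw₁ hw₂ hbL hy₁ hy₂ haR h1 h2 hab.symm hne with rfl | rfl
          · exact hb (.inl (h.near_unique hbL hw₁ hw₂ hy₁ hy₂ hab.symm h1 h2 hne))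
          · exact hr ha.2
    rcases hs (insert w₁ Q) {w₁} {y | G.Adj w₁ y} hcut with hsub | hsub
    · have := hsub (mem_insert _ _) (mem_insert_of_mem _ hy₁Q)
      exact hw₁R (this ▸ hy₁)
    · have : u = w₂ := by
        refine hsub ?_ ?_
        · rintro (e | ⟨hu, -⟩)
          · exact hw₁.1 e.symm
          · exact hu.1 rfl
        · rintro (e | ⟨hw, -⟩)
          · exact hw₁₂ e.symm
          · exact hw₂R hw
      exact hw₂.1 this.symm

/-- Apart from `u` and the far vertex, the graph is bipartite between the first two layers. The
missing pairs `D` fall into the classes of `Meets`, inside which missing sets are nested. Kind `2`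
never occurs. -/
theorem Layering.branchTree [Finite V] (h : Layering G u)
    (hfar : {y | FarFrom G u y}.Subsingleton) : BranchTree (CutBound G (60 + 2 ^ 60)) univ := by
  classical
  have : Nonempty V := ⟨u⟩
  have hT := h.triangleFree
  have hE := h.forkFree
  have h5 := h.pentagonFree
  let D : V → V → Prop := fun a b => ¬ G.Adj a b ∧
    (G.Adj u a ∧ SecondLayer G u b ∨ SecondLayer G u a ∧ G.Adj u b)
  -- A block is named by its `Meets` class: that of the vertex itself in the second layer, or that
  -- of any vertex missing it in the first.
  let blk : V → Set V := fun v => {w' | SecondLayer G u w' ∧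
    ∃ w, SecondLayer G u w ∧ (v = w ∨ Missing G u w v) ∧ Meets G u w w'}
  have hblk : ∀ w, SecondLayer G u w → blk w = {w' | SecondLayer G u w' ∧ Meets G u w w'} := by
    intro w hw
    ext w'
    refine and_congr_right fun hw' => ⟨?_, fun hm => ⟨w, hw, .inl rfl, hm⟩⟩
    rintro ⟨w₀, hw₀, rfl | hm, hm'⟩
    · exact hm'
    · exact (hw.2.1 hm.1).elim
  have hmiss : ∀ w x, SecondLayer G u w → Missing G u w x → blk x = blk w := by
    intro w x hw hx
    rw [hblk w hw]
    ext w'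
    refine and_congr_right fun hw' => ⟨?_, fun hm => ⟨w, hw, .inr hx, hm⟩⟩
    rintro ⟨w₀, hw₀, rfl | hm, hm'⟩
    · exact (hw₀.2.1 hx.1).elim
    · exact Meets.trans hT hE h5 hw hw₀ hw' ⟨x, hx, hm⟩ hm'
  have hmeets : ∀ w w', SecondLayer G u w → SecondLayer G u w' → blk w = blk w' →
      Meets G u w w' := by
    intro w w' hw hw' e
    obtain ⟨x, hx⟩ := h.exists_missing w' hw'
    have hmem : w' ∈ blk w := by
      rw [e, hblk w' hw']
      exact ⟨hw', x, hx, hx⟩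
    rw [hblk w hw] at hmem
    exact hmem.2
  have hchain : ∀ x x' w w', SecondLayer G u w → SecondLayer G u w' → G.Adj u x → G.Adj u x' →
      blk w = blk w' → ¬ G.Adj x w → ¬ G.Adj x' w' → ¬ G.Adj x w' ∨ ¬ G.Adj x' w := by
    intro x x' w w' hw hw' hx hx' e hxw hxw'
    rcases Meets.comparable hE h5 hw hw' (hmeets w w' hw hw' e) with hc | hc
    · exact .inl fun e => (hc x ⟨hx, fun e => hxw e.symm⟩).2 e.symm
    · exact .inr fun e => (hc x' ⟨hx', fun e => hxw' e.symm⟩).2 e.symm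
  have hF : (insert u {y | FarFrom G u y}).ncard ≤ 2 := by
    have h1 := Set.ncard_insert_le u {y | FarFrom G u y}
    have h2 := (Set.ncard_le_one_iff_subsingleton (s := {y | FarFrom G u y})).2 hfar
    omega
  have hcov : ∀ a ∉ insert u {y | FarFrom G u y}, ¬ G.Adj u a → SecondLayer G u a := by
    intro a ha hn
    by_contra h2
    exact ha (.inr ⟨fun e => ha (.inl e), hn, h2⟩)
  refine branchTree_of_blocks_of_exceptions G (κ := Bool) _ hF (m := 60) (by simp) blk
    (fun v => if G.Adj u v then 0 else 1) (fun v => decide (G.Adj u v)) D (fun s t => s ≠ t)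
    ?_ ?_ ?_ ?_ ?_
  · rintro a b ⟨hn, h⟩
    exact ⟨fun e => hn e.symm, h.symm.imp And.symm And.symm⟩
  · rintro a b ⟨hn, ⟨ha, hb⟩ | ⟨ha, hb⟩⟩
    · refine ⟨?_, hmiss b a hb ⟨ha, fun e => hn e.symm⟩, by simp [ha, hb.2.1]⟩
      rintro (rfl | hfar)
      · exact G.irrefl ha
      · exact hfar.2.1 ha
    · refine ⟨?_, (hmiss a b ha ⟨hb, hn⟩).symm, by simp [hb, ha.2.1]⟩
      rintro (rfl | hfar)
      · exact ha.1 rfl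
      · exact hfar.2.2 ha
  · rintro x x' y y' hb1 hb2 hb3 hx hy - ⟨hn, hxy⟩ ⟨hn', hxy'⟩
    have hx : G.Adj u x ↔ G.Adj u x' := by
      by_cases e : G.Adj u x <;> by_cases e' : G.Adj u x' <;> simp [e, e'] at hx ⊢
    rcases hxy with ⟨h1, h2⟩ | ⟨h1, h2⟩
    · rcases hxy' with ⟨h1', h2'⟩ | ⟨h1', h2'⟩
      · exact (hchain x x' y y' h2 h2' h1 h1' (hb2.symm.trans hb3) hn hn').imp
          (fun e => ⟨e, .inl ⟨h1, h2'⟩⟩) fun e => ⟨e, .inl ⟨h1', h2⟩⟩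
      · exact (h1'.2.1 (hx.1 h1)).elim
    · rcases hxy' with ⟨h1', h2'⟩ | ⟨h1', h2'⟩
      · exact (h1.2.1 (hx.2 h1')).elim
      · exact ((hchain y y' x x' h1 h1' h2 h2' hb1 (fun e => hn e.symm) fun e => hn' e.symm).imp
          (fun e => ⟨fun e' => e e'.symm, .inr ⟨h1', h2⟩⟩)
          fun e => ⟨fun e' => e e'.symm, .inr ⟨h1, h2'⟩⟩).symm
  · intro x w y _ _ _ _ hy
    by_cases e : G.Adj u y <;> simp [e] at hy
  · intro a ha b hb hab
    by_cases e : G.Adj u a <;> by_cases e' : G.Adj u b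
    · have hn : ¬ G.Adj a b := hT _ _ _ e.symm e'
      have h1 : ¬ SecondLayer G u a := fun h => h.2.1 e
      have h2 : ¬ SecondLayer G u b := fun h => h.2.1 e'
      simp [D, e, e', hn, h1, h2]
    · simp [D, e, e', hcov b hb e']
    · simp [D, e, e', hcov a ha e]
    · have hn : ¬ G.Adj a b := (hcov a ha e).not_adj h5 (hcov b hb e')
      simp [D, e, e', hn]

/-- A second-layer vertex seeing all neighbours of a vertex `u` of maximum degree would have exactly
the same neighbours, hence be its twin. -/
theorem exists_layering [Finite V] (hT : TriangleFree G) (hE : ForkFree G) (h5 : PentagonFree G)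
    (hs : SplitFree G) (hc : 4 ≤ Nat.card V) : ∃ u, Layering G u := by
  have : Nonempty V := Nat.card_pos_iff.1 (by omega) |>.1
  obtain ⟨u, hu⟩ := Finite.exists_max fun v => (G.neighborSet v).ncard
  refine ⟨u, hT, hE, h5, fun w hw => ?_, fun p q => hs.eq_of_twins hc⟩
  by_contra! hn
  have hsub : G.neighborSet u ⊆ G.neighborSet w := by
    intro x hx
    by_contra hwx
    exact hn x ⟨hx, hwx⟩
  have heq := Set.eq_of_subset_of_ncard_le hsub (hu w)
  exact hw.1 (hs.eq_of_twins hc fun y => by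
    rw [← SimpleGraph.mem_neighborSet, ← heq, SimpleGraph.mem_neighborSet])

/-- Every split-free graph in the class has a bounded branch tree. -/
theorem branchTree_of_forkFree [Finite V] [Nonempty V] (hT : TriangleFree G) (hE : ForkFree G)
    (hs : SplitFree G) : BranchTree (CutBound G (60 + 2 ^ 60)) univ := by
  by_cases hc : 4 ≤ Nat.card V
  · by_cases h5 : PentagonFree G
    · by_cases h7 : ∃ n, 7 ≤ n ∧ ∃ p : ZMod n → V, IsHole G p
      · obtain ⟨n, hn, p, hp⟩ := h7
        have := hp.branchTree (by omega) (hp.surjective hE h5 hs hc hn)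
        have := this.map id Function.injective_id (Q := CutBound G (60 + 2 ^ 60)) fun T _ hT => by
          rw [image_id]
          exact hT.mono (by norm_num)
        rwa [image_id] at this
      · push Not at h7
        obtain ⟨u, hu⟩ := exists_layering hT hE h5 hs hc
        exact hu.branchTree (hu.far_subsingleton hs hc h7)
    · unfold PentagonFree at h5
      push Not at h5
      obtain ⟨a, b, c, d, e, hab, hbc, hcd, hde, hea⟩ := h5
      refine branchTree_of_pentagon (p := ![a, b, c, d, e]) hT hE (fun i => ?_) hs hc
      fin_cases i <;> assumption
  · obtain ⟨e⟩ : Nonempty (V ≃ Fin (Nat.card V)) := ⟨Finite.equivFin V⟩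
    refine branchTree_of_layout G (κ := Fin 4) (m := 60) (by simp) (fun v => (e v).1)
      (Fin.val_injective.comp e.injective) fun n => ⟨fun v => ⟨(e v).1, by omega⟩, ?_⟩
    intro x x' _ _ hxx y _ hxy
    have : (e x).1 = (e x').1 := Fin.mk.inj hxx
    rwa [← e.injective (Fin.ext this)]

theorem triangleFree_of_not_isIndContained
    (h : ¬ (SimpleGraph.completeGraph (Fin 3)).IsIndContained G) : TriangleFree G := by
  intro a b c hab hbc hac
  refine h ⟨⟨⟨![a, b, c], ?_⟩, ?_⟩⟩
  · intro i j hij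
    have h1 := hab.ne
    have h2 := hbc.ne
    have h3 := hac.ne
    fin_cases i <;> fin_cases j <;> simp_all
  · intro i j
    change G.Adj (![a, b, c] i) (![a, b, c] j) ↔ i ≠ j
    fin_cases i <;> fin_cases j <;> simp [hab, hbc, hac, hab.symm, hbc.symm, hac.symm]

/-- Triangle-freeness supplies the nonedges not listed in `ForkFree`, and the adjacency pattern
forces the six vertices to be distinct. -/
theorem forkFree_of_not_isIndContained (hT : TriangleFree G)
    (h : ¬ (subdividedClaw 1 2 2).IsIndContained G) : ForkFree G := by
  intro c x y y' z z' hx hy hz hyy hzz hxy hxz hyz hzy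
  by_contra hn
  let f : Option (Fin 1 ⊕ Fin 2 ⊕ Fin 2) → V := fun
    | none => c
    | some (.inl _) => x
    | some (.inr (.inl a)) => ![y, y'] a
    | some (.inr (.inr a)) => ![z, z'] a
  have n1 : ¬ G.Adj x y := hT _ _ _ hx.symm hy
  have n2 : ¬ G.Adj x z := hT _ _ _ hx.symm hz
  have n3 : ¬ G.Adj y z := hT _ _ _ hy.symm hz
  have n4 : ¬ G.Adj c y' := hT _ _ _ hy hyy
  have n5 : ¬ G.Adj c z' := hT _ _ _ hz hzz
  have hadj : ∀ i j, G.Adj (f i) (f j) ↔ (subdividedClaw 1 2 2).Adj i j := by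
    rintro (_ | i | i | i) (_ | j | j | j) <;> (try fin_cases i) <;> (try fin_cases j) <;>
      simp [f, subdividedClaw, *, G.adj_comm x c, G.adj_comm y c, G.adj_comm z c,
        G.adj_comm y' c, G.adj_comm z' c, G.adj_comm y x, G.adj_comm z x, G.adj_comm z y,
        G.adj_comm y' y, G.adj_comm z' z, G.adj_comm y' x, G.adj_comm z' x, G.adj_comm z' y,
        G.adj_comm y' z, G.adj_comm z' y']
  have m1 : x ≠ y := fun e => hxy (e ▸ hyy)
  have m2 : x ≠ z := fun e => hxz (e ▸ hzz)
  have m3 : y ≠ z := fun e => hyz (e ▸ hzz)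
  have m4 : c ≠ y' := fun e => hzy (e ▸ hz.symm)
  have m5 : c ≠ z' := fun e => hyz (e ▸ hy.symm)
  have m6 : x ≠ y' := fun e => n4 (e ▸ hx)
  have m7 : x ≠ z' := fun e => n5 (e ▸ hx)
  have m8 : y ≠ z' := fun e => n5 (e ▸ hy)
  have m9 : z ≠ y' := fun e => n4 (e ▸ hz)
  have m10 : y' ≠ z' := fun e => hyz (e ▸ hyy)
  have hinj : Function.Injective f := by
    rintro (_ | i | i | i) (_ | j | j | j) <;> (try fin_cases i) <;> (try fin_cases j) <;>
      simp [f, hx.ne, hy.ne, hz.ne, hyy.ne, hzz.ne, m1, m2, m3, m4, m5, m6, m7, m8, m9, m10,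
        hx.ne.symm, hy.ne.symm, hz.ne.symm, hyy.ne.symm, hzz.ne.symm, m1.symm, m2.symm, m3.symm,
        m4.symm, m5.symm, m6.symm, m7.symm, m8.symm, m9.symm, m10.symm]
  exact h ⟨⟨⟨f, hinj⟩, hadj _ _⟩⟩

end HoleFree

theorem mainTheorem2 :
    ∃ k : ℕ, ∀ (V : Type*) [Finite V] (G : SimpleGraph V),
      ¬ (subdividedClaw 1 2 2).IsIndContained G →
      ¬ (SimpleGraph.completeGraph (Fin 3)).IsIndContained G →
      (SimpleGraph.cycleGraph 5).IsIndContained G →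
      cliqueWidth G ≤ (k : ℕ∞) := by
  -- `CutBound` at `60 + 2 ^ 60` uses one more label, and `BuiltOn` triples the number of labels.
  refine ⟨3 * (60 + 2 ^ 60 + 1), fun V _ G hE hT hC => ?_⟩
  have hT := triangleFree_of_not_isIndContained hT
  have hE := forkFree_of_not_isIndContained hT hE
  obtain ⟨f⟩ := hC
  have : Nonempty V := ⟨f 0⟩
  refine BuiltOn.cliqueWidth_le (builtOn_of_branchTree ?_)
  refine branchTree_of_splitFree (fun G => TriangleFree G ∧ ForkFree G) ?_
    (fun G hG => branchTree_of_forkFree hG.1 hG.2) G ⟨hT, hE⟩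
  rintro V G s ⟨hT, hE⟩
  exact ⟨fun a b c => hT a b c, fun c x y y' z z' => hE c x y y' z z'⟩
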